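/- **Setting.** Let $n,q\ge 0$, $s\ge 1$. For subject $i=1,2,\dots$ we observe responses $Y_i=(Y_{i1},\dots,Y_{in})^T$ and covariate vectors $X_{i1},\dots,X_{in}\in\mathbb R^q$; the pairs $(Y_i,X_i)$ are independent with common law $F$. Let $h$ (inverse link) and $v$ (variance function) be real functions which on an open set $I\subseteq\mathbb R$ are continuously differentiable, respectively continuous and strictly positive; let $\phi>0$, let $\mathcal B\subset\mathbb R^q$ be compact and $\beta_0\in\operatorname{int}\mathcal B$ the true parameter. Almost surely $X_{1t}^T\beta\in I$ for all $\beta\in\mathcal B$ and all $t$; the $Y_{1t}$ are integrable, $E(Y_{1t}\mid X_1)=h(X_{1t}^T\beta_0)$ and $\operatorname{var}(Y_{1t}\mid X_1)=\phi\, v(X_{1t}^T\beta_0)$. Let $M_1=I_n,M_2,\dots,M_s$ be real $n\times n$ matrices. With $h_i(\beta)=(h(X_{it}^T\beta))_{t}$, $A_i(\beta)=\operatorname{diag}_t(\phi\, v(X_{it}^T\beta))$ and $\nabla$ the derivative in $\beta$, let $g_i(\beta)\in\mathbb R^{qs}$ be the vector with the blocks $$\nabla h_i^T A_i^{-1/2}M_jA_i^{-1/2}(Y_i-h_i),\qquad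 j=1,\dots,s,$$ and put $\bar g_N=\frac1N\sum_{i\le N} g_i$, $\hat C_N=\frac1N\sum_{i\le N} g_ig_i^T$, $$Q_N(\beta)=N\,\bar g_N(\beta)^T\,\hat C_N(\beta)^{-1}\,\bar g_N(\beta),$$ where the inverse of a singular matrix is understood as any fixed choice of generalized inverse. Let $\Sigma(\beta)=E\{g_1(\beta)g_1(\beta)^T\}$, $D(\beta)=E\{\nabla g_1(\beta)\}$, $J=D(\beta_0)^T\Sigma(\beta_0)^{-1}D(\beta_0)$ and $Z_N=\frac{1}{2\sqrt N}\nabla Q_N(\beta_0)$. **Assumptions.** (i) For $\beta\in\mathcal B$, $E\{g_1(\beta)\}=0$ only if $\beta=\beta_0$. (ii) $\Sigma(\beta)$ is positive definite for every $\beta\in\mathcal B$. (iii) Almost surely $g_1$ is twice continuously differentiable on $\operatorname{int}\mathcal B$ with uniformly continuous second-order derivatives. (iv) The suprema over $\beta\in\mathcal B$ of the absolute values of the entries of $g_1(\beta)$ and $g_1(\beta)g_1(\beta)^T$, and the suprema over $\beta\in\operatorname{int}\mathcal B$ of the absolute values of their first- and second-order partial derivatives, are bounded by integrable random variables. **Theorem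 (null asymptotic distribution of $T_N$).** Let $L$ be a real $q\times p$ matrix with linearly independent columns, $b\in\mathbb R^p$, and suppose that the hypothesis $H_0: L^T\beta=b$ is true, i.e. $L^T\beta_0=b$. For every $N$ let the random vectors $\hat\beta_N$ and $\tilde\beta_N$ almost surely minimize $Q_N$ over $\mathcal B$ and over $\{\beta\in\mathcal B: L^T\beta=b\}$, respectively, and let $T_N=Q_N(\tilde\beta_N)-Q_N(\hat\beta_N)$. Then $J$ is positive definite, $$T_N=\{L^TJ^{-1}Z_N\}^T\{L^TJ^{-1}L\}^{-1}\{L^TJ^{-1}Z_N\}+o_p(1)\qquad(N\to\infty),$$ and $T_N$ converges in distribution to $\chi^2_p$ as $N\to\infty$. -/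

import Mathlib

open MeasureTheory ProbabilityTheory Filter Topology
open scoped Matrix

noncomputable section

namespace QIF

/-- One subject's data `(Y, X)`: the `n` responses and, for each time point `t`, the covariate
vector `X_t ∈ ℝ^q`. -/
abbrev Datum (n q : ℕ) : Type := (Fin n → ℝ) × (Fin n → Fin q → ℝ)

/-- The user-chosen ingredients: inverse link `h`, variance function `v`, dispersion `φ`, the set
`dom` of admissible values of the linear predictor, and the basis matrices `M₁, …, M_s`
(indexed from `0`). -/
structure Spec (n q s : ℕ) where
  h : ℝ → ℝ
  v : ℝ → ℝ
  φ : ℝ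
  dom : Set ℝ
  M : Fin s → Matrix (Fin n) (Fin n) ℝ

variable {n q s : ℕ}

/-- Partial derivative of `f` in the `k`-th coordinate of the parameter. -/
def partialDeriv (f : (Fin q → ℝ) → ℝ) (k : Fin q) (β : Fin q → ℝ) : ℝ :=
  fderiv ℝ f β (Pi.single k 1)

namespace Spec

variable (S : Spec n q s)

/-- The mean vector `(h(X_tᵀ β))_t`. -/
def meanVec (x : Fin n → Fin q → ℝ) (β : Fin q → ℝ) : Fin n → ℝ :=
  fun t => S.h (x t ⬝ᵥ β)

/-- The `n × q` matrix of partial derivatives of the mean vector. -/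
def meanJac (x : Fin n → Fin q → ℝ) (β : Fin q → ℝ) : Matrix (Fin n) (Fin q) ℝ :=
  Matrix.of fun t k => partialDeriv (fun b => S.meanVec x b t) k β

/-- `A^{-1/2}`, where `A` is the diagonal matrix with entries `φ v(X_tᵀ β)`. -/
def invSqrtVar (x : Fin n → Fin q → ℝ) (β : Fin q → ℝ) : Matrix (Fin n) (Fin n) ℝ :=
  Matrix.diagonal fun t => (√(S.φ * S.v (x t ⬝ᵥ β)))⁻¹

/-- The subject-specific extended score `g(β) ∈ ℝ^{qs}`; the index `(j, k)` is the `k`-th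
coordinate of the `j`-th block `(∇h)ᵀ A^{-1/2} M_j A^{-1/2} (Y - h)`. -/
def score (z : Datum n q) (β : Fin q → ℝ) : Fin s × Fin q → ℝ :=
  fun a => (((S.meanJac z.2 β)ᵀ * S.invSqrtVar z.2 β * S.M a.1 * S.invSqrtVar z.2 β) *ᵥ
    (z.1 - S.meanVec z.2 β)) a.2

/-- `ḡ_N(β)`, the average of the first `N` scores of the data sequence `ζ`. -/
def meanScore (N : ℕ) (ζ : ℕ → Datum n q) (β : Fin q → ℝ) : Fin s × Fin q → ℝ :=
  (N : ℝ)⁻¹ • ∑ i ∈ Finset.range N, S.score (ζ i) β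

/-- `Ĉ_N(β) = N⁻¹ ∑ g_i(β) g_i(β)ᵀ`. -/
def sampleMoment (N : ℕ) (ζ : ℕ → Datum n q) (β : Fin q → ℝ) :
    Matrix (Fin s × Fin q) (Fin s × Fin q) ℝ :=
  (N : ℝ)⁻¹ • ∑ i ∈ Finset.range N, Matrix.vecMulVec (S.score (ζ i) β) (S.score (ζ i) β)

end Spec

/-- `G` assigns to every square matrix a generalized inverse; `G C` is the usual inverse of `C`
whenever `C` is nonsingular. -/
def IsGenInverse {r : Type*} [Fintype r] (G : Matrix r r ℝ → Matrix r r ℝ) : Prop :=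
  ∀ C, C * G C * C = C

namespace Spec

variable (S : Spec n q s)

/-- The quadratic inference function `Q_N(β) = N ḡ_N(β)ᵀ Ĉ_N(β)⁻¹ ḡ_N(β)`, where the inverse is
taken with the generalized inverse `G` (as `Ĉ_N(β)` may be singular). -/
def qif (G : Matrix (Fin s × Fin q) (Fin s × Fin q) ℝ → Matrix (Fin s × Fin q) (Fin s × Fin q) ℝ)
    (N : ℕ) (ζ : ℕ → Datum n q) (β : Fin q → ℝ) : ℝ :=
  N * (S.meanScore N ζ β ⬝ᵥ (G (S.sampleMoment N ζ β) *ᵥ S.meanScore N ζ β))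

/-- `Z_N = (2√N)⁻¹ ∇Q_N(β₀)`. -/
def scaledGrad
    (G : Matrix (Fin s × Fin q) (Fin s × Fin q) ℝ → Matrix (Fin s × Fin q) (Fin s × Fin q) ℝ)
    (N : ℕ) (ζ : ℕ → Datum n q) (β₀ : Fin q → ℝ) : Fin q → ℝ :=
  fun k => 1 / (2 * √(N : ℝ)) * partialDeriv (S.qif G N ζ) k β₀

/-- `Σ(β) = E{g(β) g(β)ᵀ}`. -/
def momentMatrix (F : Measure (Datum n q)) (β : Fin q → ℝ) :
    Matrix (Fin s × Fin q) (Fin s × Fin q) ℝ :=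
  Matrix.of fun a b => ∫ z, S.score z β a * S.score z β b ∂F

/-- `D(β) = E{∇g(β)}`, a `qs × q` matrix. -/
def meanScoreJac (F : Measure (Datum n q)) (β : Fin q → ℝ) : Matrix (Fin s × Fin q) (Fin q) ℝ :=
  Matrix.of fun a k => ∫ z, partialDeriv (fun b => S.score z b a) k β ∂F

/-- `J(β) = D(β)ᵀ Σ(β)⁻¹ D(β)`. -/
def infoMatrix (F : Measure (Datum n q)) (β : Fin q → ℝ) : Matrix (Fin q) (Fin q) ℝ :=
  (S.meanScoreJac F β)ᵀ * (S.momentMatrix F β)⁻¹ * S.meanScoreJac F β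

end Spec

/-- `E sup_{β ∈ B} |f(·, β)| < ∞`, in the form of an integrable envelope. -/
def HasEnvelope (F : Measure (Datum n q)) (f : Datum n q → (Fin q → ℝ) → ℝ)
    (B : Set (Fin q → ℝ)) : Prop :=
  ∃ H : Datum n q → ℝ, Integrable H F ∧ ∀ᵐ z ∂F, ∀ β ∈ B, |f z β| ≤ H z

/-- The σ-algebra generated by the covariates. -/
abbrev covariateSigma (n q : ℕ) : MeasurableSpace (Datum n q) :=
  MeasurableSpace.comap Prod.snd inferInstance

/-- The model and its regularity conditions, for the law `F` of one subject's data, the parameter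
space `B` and the true parameter `β₀`. -/
structure Regular [NeZero s] (S : Spec n q s) (F : Measure (Datum n q)) (B : Set (Fin q → ℝ))
    (β₀ : Fin q → ℝ) : Prop where
  /-- the first basis matrix is the identity -/
  basis_zero : S.M 0 = 1
  dispersion_pos : 0 < S.φ
  /-- the link and variance functions are sufficiently regular where they are evaluated -/
  isOpen_dom : IsOpen S.dom
  link_contDiffOn : ContDiffOn ℝ 1 S.h S.dom
  var_continuousOn : ContinuousOn S.v S.dom
  var_pos : ∀ η ∈ S.dom, 0 < S.v η
  linPred_mem : ∀ᵐ z ∂F, ∀ β ∈ B, ∀ t, z.2 t ⬝ᵥ β ∈ S.dom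
  /-- the mean and variance model, conditionally on the covariates, at the true parameter -/
  response_integrable : ∀ t, Integrable (fun z : Datum n q => z.1 t) F
  cond_mean : ∀ t, F[fun z : Datum n q => z.1 t | covariateSigma n q]
    =ᵐ[F] fun z => S.h (z.2 t ⬝ᵥ β₀)
  cond_var : ∀ t, condVar (covariateSigma n q) (fun z : Datum n q => z.1 t) F
    =ᵐ[F] fun z => S.φ * S.v (z.2 t ⬝ᵥ β₀)
  /-- compact parameter space, with the true parameter in its interior -/
  isCompact : IsCompact B
  true_mem : β₀ ∈ interior B
  /-- identifiability -/
  identifiable : ∀ β ∈ B, (∀ a, ∫ z, S.score z β a ∂F = 0) → β = β₀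
  /-- nondegenerate second moments of the score -/
  moment_posDef : ∀ β ∈ B, (S.momentMatrix F β).PosDef
  /-- uniformly continuous second-order derivatives of the score -/
  score_contDiffOn : ∀ᵐ z ∂F, ContDiffOn ℝ 2 (S.score z) (interior B)
  score_uniformContinuousOn : ∀ᵐ z ∂F,
    UniformContinuousOn (iteratedFDeriv ℝ 2 (S.score z)) (interior B)
  /-- finite expectations, uniformly over the parameter space, of `g`, `g gᵀ` and their first and
  second derivatives -/
  score_envelope : ∀ a, HasEnvelope F (fun z β => S.score z β a) B
  prod_envelope : ∀ a b, HasEnvelope F (fun z β => S.score z β a * S.score z β b) B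
  score_deriv_envelope : ∀ a, ∀ k ∈ Finset.Icc 1 2,
    HasEnvelope F (fun z β => ‖iteratedFDeriv ℝ k (fun b => S.score z b a) β‖) (interior B)
  prod_deriv_envelope : ∀ a a', ∀ k ∈ Finset.Icc 1 2,
    HasEnvelope F (fun z β => ‖iteratedFDeriv ℝ k (fun b => S.score z b a * S.score z b a') β‖)
      (interior B)

/-- `x` is a minimizer of `f` over `K`. -/
def IsArgMin (f : (Fin q → ℝ) → ℝ) (K : Set (Fin q → ℝ)) (x : Fin q → ℝ) : Prop :=
  x ∈ K ∧ IsMinOn f K x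

/-- The chi-squared distribution with `p` degrees of freedom: the law of the sum of the squares of
`p` independent standard normal variables. -/
def chiSquared (p : ℕ) : Measure ℝ :=
  (Measure.pi fun _ : Fin p => gaussianReal 0 1).map fun x => ∑ i, x i ^ 2

instance (p : ℕ) : IsProbabilityMeasure (chiSquared p) :=
  Measure.isProbabilityMeasure_map
    (Finset.measurable_sum _ fun i _ => (measurable_pi_apply i).pow_const 2).aemeasurable

end QIF

end

/-! On the scale β = β₀ + u/√N the averaged score is nearly linear: with ξ_N = √N ḡ_N(β₀), the
objective is close to the quadratic (ξ_N + Du)ᵀ Σ⁻¹ (ξ_N + Du), where D and Σ are taken at β₀.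
Completing the square shows that its minimum under Lᵀu = 0 exceeds its free minimum by exactly the
Wald form at z = DᵀΣ⁻¹ξ_N (`exists_constrained_minimizer`). Moreover Z_N = z + o_p(1), because the
derivative of Ĉ_N enters Z_N only with a factor N^(-1/2) (`tendsto_scaledGrad`). The Wald form at z
equals |Rξ_N|² for a matrix R with RΣRᵀ = I (`exists_waldForm_eq_sum_sq`), so the central limit
theorem for R g_i(β₀) and Slutsky's lemma give the χ² limit.

Convergence in probability is expressed as convergence along one filter, `probFilter P`. Since ξ_N
is tight, a limit in probability may be tested on the finer ultrafilters along which ξ_N converges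
to a fixed vector ξ (`tendsto_of_normalizedScore`). There the uniform law of large numbers yields
the purely deterministic hypotheses `ScoreLimit`, and compactness arguments, with ultrafilters in
place of subsequences, give consistency (`tendsto_argMin`), the √N rate (`exists_tendsto_rescaled`)
and the limiting minimum (`tendsto_objective_argMin`).

Positive definiteness of J amounts to injectivity of D. If Dc = 0, conditioning on the covariates
and contracting the block of the identity matrix with c shows that E Σ_t (h' X_tᵀc)²/(φv) = 0. Then
the same combination of the scores of that block vanishes almost surely, which contradicts Σ > 0
unless c = 0 (`meanScoreJac_mulVec_injective`). -/

namespace QIF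

/-! ### Quadratic forms, generalized inverses and constrained least squares. -/

section LinearAlgebra

set_option linter.unusedSectionVars false

variable {ι r m k : Type*} [Fintype r] [Fintype m] [Fintype k]

lemma dotProduct_mulVec_comm {C : Matrix r r ℝ} (hC : Cᵀ = C) (x y : r → ℝ) :
    x ⬝ᵥ (C *ᵥ y) = y ⬝ᵥ (C *ᵥ x) := by
  rw [Matrix.dotProduct_mulVec, ← Matrix.mulVec_transpose, hC, dotProduct_comm]

lemma transpose_mulVec_dotProduct (A : Matrix r m ℝ) (x : r → ℝ) (y : m → ℝ) :
    (Aᵀ *ᵥ x) ⬝ᵥ y = x ⬝ᵥ (A *ᵥ y) := by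
  rw [Matrix.mulVec_transpose, ← Matrix.dotProduct_mulVec]

lemma posSemidef_transpose {C : Matrix r r ℝ} (hC : C.PosSemidef) : Cᵀ = C := by
  simpa [Matrix.conjTranspose_eq_transpose_of_trivial] using hC.isHermitian.eq

lemma quadForm_nonneg {C : Matrix r r ℝ} (hC : C.PosSemidef) (x : r → ℝ) :
    0 ≤ x ⬝ᵥ (C *ᵥ x) := by
  simpa using hC.dotProduct_mulVec_nonneg x

lemma quadForm_pos {C : Matrix r r ℝ} (hC : C.PosDef) {x : r → ℝ} (hx : x ≠ 0) :
    0 < x ⬝ᵥ (C *ᵥ x) := by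
  simpa using hC.dotProduct_mulVec_pos hx

/-- Symmetry moves one factor `C` across, leaving `C * G C * C`. Hence on the range of `C` the form
does not depend on the generalized inverse chosen. -/
lemma genInverse_quadForm {G : Matrix r r ℝ → Matrix r r ℝ} (hG : IsGenInverse G)
    {C : Matrix r r ℝ} (hC : Cᵀ = C) (u : r → ℝ) :
    (C *ᵥ u) ⬝ᵥ (G C *ᵥ (C *ᵥ u)) = u ⬝ᵥ (C *ᵥ u) := by
  conv_lhs => rw [← hC]
  rw [transpose_mulVec_dotProduct, hC, Matrix.mulVec_mulVec, Matrix.mulVec_mulVec, hG C]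

/-- Expand the nonnegative form of `C` at `x - u`. Equality at `x = u` makes this a variational
formula, used for the coordinate bound `sq_apply_le` and for measurability of the objective. -/
lemma two_mul_dotProduct_sub_le {C : Matrix r r ℝ} (hC : C.PosSemidef) (u x : r → ℝ) :
    2 * (x ⬝ᵥ (C *ᵥ u)) - x ⬝ᵥ (C *ᵥ x) ≤ u ⬝ᵥ (C *ᵥ u) := by
  have h := quadForm_nonneg hC (x - u)
  have h' := dotProduct_mulVec_comm (posSemidef_transpose hC) x u
  simp only [Matrix.mulVec_sub, dotProduct_sub, sub_dotProduct] at h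
  linarith

lemma tendsto_mulVec {l : Filter ι} {M : ι → Matrix r m ℝ} {A : Matrix r m ℝ} {x : ι → m → ℝ}
    {y : m → ℝ} (hM : Tendsto M l (𝓝 A)) (hx : Tendsto x l (𝓝 y)) :
    Tendsto (fun i => M i *ᵥ x i) l (𝓝 (A *ᵥ y)) :=
  ((continuous_fst.matrix_mulVec continuous_snd).tendsto (A, y)).comp (hM.prodMk_nhds hx)

lemma tendsto_dotProduct {l : Filter ι} {x x' : ι → r → ℝ} {y y' : r → ℝ}
    (hx : Tendsto x l (𝓝 y)) (hx' : Tendsto x' l (𝓝 y')) :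
    Tendsto (fun i => x i ⬝ᵥ x' i) l (𝓝 (y ⬝ᵥ y')) :=
  ((continuous_fst.dotProduct continuous_snd).tendsto (y, y')).comp (hx.prodMk_nhds hx')

lemma posDef_transpose_mul_inv_mul [DecidableEq m] {J : Matrix m m ℝ} (hJ : J.PosDef)
    {L : Matrix m k ℝ}
    (hL : Function.Injective L.mulVec) : (Lᵀ * J⁻¹ * L).PosDef := by
  have := hJ.inv.conjTranspose_mul_mul_same hL
  rwa [Matrix.conjTranspose_eq_transpose_of_trivial] at this

variable [DecidableEq r]

lemma genInverse_eq_inv {G : Matrix r r ℝ → Matrix r r ℝ} (hG : IsGenInverse G)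
    {C : Matrix r r ℝ} (hC : C.det ≠ 0) : G C = C⁻¹ := by
  have hu : IsUnit C.det := isUnit_iff_ne_zero.2 hC
  have h := hG C
  have : C⁻¹ * (C * G C * C) * C⁻¹ = C⁻¹ * C * C⁻¹ := by rw [h]
  rw [Matrix.nonsing_inv_mul _ hu, one_mul, mul_assoc, mul_assoc, mul_assoc,
    Matrix.mul_nonsing_inv _ hu, mul_one, ← mul_assoc, Matrix.nonsing_inv_mul _ hu, one_mul] at this
  exact this

/-- The variational inequality tested on one coordinate axis. It turns a bound on the objective into
a bound on each coordinate of the normalized score. -/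
lemma sq_apply_le {C : Matrix r r ℝ} (hC : C.PosDef) (w : r → ℝ) (a : r) :
    w a ^ 2 ≤ C a a * (w ⬝ᵥ (C⁻¹ *ᵥ w)) := by
  have hu : IsUnit C.det := isUnit_iff_ne_zero.2 hC.det_pos.ne'
  have hca : 0 < C a a := hC.diag_pos
  have hw : C *ᵥ (C⁻¹ *ᵥ w) = w := by
    rw [Matrix.mulVec_mulVec, Matrix.mul_nonsing_inv _ hu, Matrix.one_mulVec]
  -- The multiple `w a / C a a` maximizes 2tw_a - t²C_aa over t.
  have h := two_mul_dotProduct_sub_le hC.posSemidef (C⁻¹ *ᵥ w) (Pi.single a (w a / C a a))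
  rw [hw, dotProduct_comm (C⁻¹ *ᵥ w) w] at h
  simp only [single_dotProduct, Matrix.mulVec_single] at h
  simp at h
  have e : 2 * (w a / C a a * w a) - w a / C a a * (C a a * (w a / C a a)) = w a ^ 2 / C a a := by
    field_simp; ring
  have : w a ^ 2 / C a a ≤ w ⬝ᵥ (C⁻¹ *ᵥ w) := by
    rw [← e, div_eq_mul_inv] at *; linarith
  rwa [div_le_iff₀' hca] at this

lemma tendsto_matrix_inv {l : Filter ι} {M : ι → Matrix r r ℝ} {A : Matrix r r ℝ}
    (hM : Tendsto M l (𝓝 A)) (hA : A.det ≠ 0) :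
    Tendsto (fun i => (M i)⁻¹) l (𝓝 A⁻¹) := by
  simp only [Matrix.inv_def, Ring.inverse_eq_inv']
  have h1 : Tendsto (fun i => (M i).det) l (𝓝 A.det) :=
    ((continuous_id.matrix_det).tendsto A).comp hM
  have h2 : Tendsto (fun i => (M i).adjugate) l (𝓝 A.adjugate) :=
    ((continuous_id.matrix_adjugate).tendsto A).comp hM
  exact (h1.inv₀ hA).smul h2

variable [DecidableEq m] [DecidableEq k]

/-- The quadratic form `(Lᵀ J⁻¹ z)ᵀ (Lᵀ J⁻¹ L)⁻¹ (Lᵀ J⁻¹ z)`. -/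
noncomputable def waldForm (J : Matrix m m ℝ) (L : Matrix m k ℝ) (z : m → ℝ) : ℝ :=
  ((Lᵀ * J⁻¹) *ᵥ z) ⬝ᵥ ((Lᵀ * J⁻¹ * L)⁻¹ *ᵥ ((Lᵀ * J⁻¹) *ᵥ z))

/-- The minimum of `(ξ + D u)ᵀ V⁻¹ (ξ + D u)` over all `u` with `Lᵀ u = 0`. -/
noncomputable def constrainedMin (V : Matrix r r ℝ) (D : Matrix r m ℝ) (L : Matrix m k ℝ)
    (ξ : r → ℝ) : ℝ :=
  ξ ⬝ᵥ (V⁻¹ *ᵥ ξ) - (Dᵀ *ᵥ (V⁻¹ *ᵥ ξ)) ⬝ᵥ ((Dᵀ * V⁻¹ * D)⁻¹ *ᵥ (Dᵀ *ᵥ (V⁻¹ *ᵥ ξ))) +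
    waldForm (Dᵀ * V⁻¹ * D) L (Dᵀ *ᵥ (V⁻¹ *ᵥ ξ))

/-- Completing the square under the constraint `Lᵀ u = 0`. -/
lemma exists_constrained_minimizer {V : Matrix r r ℝ} (hV : V.PosDef) {D : Matrix r m ℝ}
    (hJ : (Dᵀ * V⁻¹ * D).PosDef) {L : Matrix m k ℝ}
    (hL : Function.Injective L.mulVec) (ξ : r → ℝ) :
    ∃ u₀ : m → ℝ, Lᵀ *ᵥ u₀ = 0 ∧
      ∀ u, Lᵀ *ᵥ u = 0 → (ξ + D *ᵥ u) ⬝ᵥ (V⁻¹ *ᵥ (ξ + D *ᵥ u)) =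
        constrainedMin V D L ξ + (u - u₀) ⬝ᵥ ((Dᵀ * V⁻¹ * D) *ᵥ (u - u₀)) := by
  set J := Dᵀ * V⁻¹ * D with hJdef
  set z := Dᵀ *ᵥ (V⁻¹ *ᵥ ξ) with hz
  have hP := posDef_transpose_mul_inv_mul hJ hL
  set R := Lᵀ * J⁻¹ * L with hR
  have hJu : IsUnit J.det := isUnit_iff_ne_zero.2 hJ.det_pos.ne'
  have hRu : IsUnit R.det := isUnit_iff_ne_zero.2 hP.det_pos.ne'
  have hVs := posSemidef_transpose hV.inv.posSemidef
  have hJs := posSemidef_transpose hJ.posSemidef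
  have hJis := posSemidef_transpose hJ.inv.posSemidef
  set w := (Lᵀ * J⁻¹) *ᵥ z with hw
  -- `lam` is the Lagrange multiplier: it is chosen so that `y`, the solution of Jy = z - L·lam,
  -- satisfies the constraint. The minimizer is `-y`.
  set lam := R⁻¹ *ᵥ w with hlam
  set y := J⁻¹ *ᵥ (z - L *ᵥ lam) with hy
  have hJy : J *ᵥ y = z - L *ᵥ lam := by
    rw [hy, Matrix.mulVec_mulVec, Matrix.mul_nonsing_inv _ hJu, Matrix.one_mulVec]
  have hLy : Lᵀ *ᵥ y = 0 := by
    have h1 : Lᵀ *ᵥ y = w - R *ᵥ lam := by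
      rw [hy, Matrix.mulVec_sub, Matrix.mulVec_sub, hw, hR]
      simp only [Matrix.mulVec_mulVec, Matrix.mul_assoc]
    rw [h1, hlam, Matrix.mulVec_mulVec, Matrix.mul_nonsing_inv _ hRu, Matrix.one_mulVec, sub_self]
  have orth : ∀ u, Lᵀ *ᵥ u = 0 → u ⬝ᵥ (L *ᵥ lam) = 0 := fun u hu => by
    rw [← transpose_mulVec_dotProduct, hu, zero_dotProduct]
  have hyJy : y ⬝ᵥ (J *ᵥ y) = z ⬝ᵥ (J⁻¹ *ᵥ z) - waldForm J L z := by
    have e1 : y ⬝ᵥ (J *ᵥ y) = z ⬝ᵥ y := by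
      rw [hJy, dotProduct_sub, orth y hLy, sub_zero, dotProduct_comm]
    have e2 : z ⬝ᵥ (J⁻¹ *ᵥ (L *ᵥ lam)) = waldForm J L z := by
      rw [dotProduct_mulVec_comm hJis, ← dotProduct_comm, ← transpose_mulVec_dotProduct,
        Matrix.mulVec_mulVec, waldForm]
    rw [e1, hy, Matrix.mulVec_sub, dotProduct_sub, e2]
  refine ⟨-y, by rw [Matrix.mulVec_neg, hLy, neg_zero], fun u hu => ?_⟩
  have huz : u ⬝ᵥ z = u ⬝ᵥ (J *ᵥ y) := by
    rw [hJy, dotProduct_sub, orth u hu, sub_zero]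
  have h1 : (D *ᵥ u) ⬝ᵥ (V⁻¹ *ᵥ ξ) = u ⬝ᵥ z := by
    rw [dotProduct_comm, ← transpose_mulVec_dotProduct, dotProduct_comm]
  have h2 : ξ ⬝ᵥ (V⁻¹ *ᵥ (D *ᵥ u)) = u ⬝ᵥ z := by
    rw [dotProduct_mulVec_comm hVs, h1]
  have h3 : (D *ᵥ u) ⬝ᵥ (V⁻¹ *ᵥ (D *ᵥ u)) = u ⬝ᵥ (J *ᵥ u) := by
    rw [dotProduct_comm, ← transpose_mulVec_dotProduct, hJdef]
    simp only [Matrix.mulVec_mulVec, Matrix.mul_assoc]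
    rw [dotProduct_comm]
  have h4 := dotProduct_mulVec_comm hJs u y
  rw [constrainedMin, ← hz, ← hJdef]
  simp only [Matrix.mulVec_add, dotProduct_add, add_dotProduct, sub_neg_eq_add, h1, h2, h3]
  linarith

end LinearAlgebra

/-! ### Deterministic asymptotics of minimizers along a filter. -/

section Deterministic

set_option linter.unusedSectionVars false

variable {ι r k : Type*} [Fintype r] {q : ℕ}

/-- The deterministic conditions on averaged scores `g i`, averaged second moments `C i` and sample
sizes `N i` along a filter from which the asymptotics of the minimizers follow. -/
structure ScoreLimit (l : Filter ι) (N : ι → ℕ) (g : ι → (Fin q → ℝ) → r → ℝ)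
    (C : ι → (Fin q → ℝ) → Matrix r r ℝ) (B : Set (Fin q → ℝ)) (β₀ : Fin q → ℝ)
    (V : (Fin q → ℝ) → Matrix r r ℝ) (D₀ : Matrix r (Fin q) ℝ) (ξ : r → ℝ) : Prop where
  size : Tendsto N l atTop
  isCompact : IsCompact B
  true_mem : β₀ ∈ interior B
  posSemidef : ∀ i β, (C i β).PosSemidef
  exists_mean : ∃ γ : r → (Fin q → ℝ) → ℝ,
    (∀ a, TendstoUniformlyOn (fun i β => g i β a) (γ a) l B) ∧ (∀ a, ContinuousOn (γ a) B) ∧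
      ∀ β ∈ B, (∀ a, γ a β = 0) → β = β₀
  moment : ∀ a b, TendstoUniformlyOn (fun i β => C i β a b) (fun β => V β a b) l B
  moment_cont : ∀ a b, ContinuousOn (fun β => V β a b) B
  posDef : ∀ β ∈ B, (V β).PosDef
  exists_deriv : ∃ K ∈ 𝓝 β₀, Convex ℝ K ∧
    (∀ᶠ i in l, ∀ a, ∀ β ∈ K, DifferentiableAt ℝ (fun b => g i b a) β) ∧
    ∃ D : r → Fin q → (Fin q → ℝ) → ℝ,
      (∀ a j, TendstoUniformlyOn (fun i β => partialDeriv (fun b => g i b a) j β) (D a j) l K) ∧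
      (∀ a j, ContinuousOn (D a j) K) ∧ ∀ a j, D a j β₀ = D₀ a j
  score : Tendsto (fun i => √(N i : ℝ) • g i β₀) l (𝓝 ξ)

lemma tendsto_comp_of_uniformlyOn {α : Type*} [TopologicalSpace α] {F : ι → α → ℝ} {f : α → ℝ}
    {l : Filter ι} {s : Set α} (hF : TendstoUniformlyOn F f l s) (hf : ContinuousOn f s)
    {x : ι → α} {y : α} (hy : y ∈ s) (hx : Tendsto x l (𝓝 y)) (hxs : ∀ᶠ i in l, x i ∈ s) :
    Tendsto (fun i => F i (x i)) l (𝓝 (f y)) := by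
  refine tendsto_comp_of_locally_uniform_limit_within (hf y hy)
    (tendsto_nhdsWithin_iff.2 ⟨hx, hxs⟩) fun u hu => ⟨s, self_mem_nhdsWithin, hF u hu⟩

lemma fderiv_apply_eq_sum (f : (Fin q → ℝ) → ℝ) (x v : Fin q → ℝ) :
    fderiv ℝ f x v = ∑ j, partialDeriv f j x * v j := by
  conv_lhs => rw [pi_eq_sum_univ' v]
  simp only [map_sum, map_smul, partialDeriv, smul_eq_mul]
  refine Finset.sum_congr rfl fun j _ => ?_
  rw [mul_comm]

lemma _root_.Ultrafilter.exists_tendsto_of_bounded {l : Ultrafilter ι} {x : ι → r → ℝ} {c : ℝ}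
    (h : ∀ᶠ i in (l : Filter ι), ∀ a, |x i a| ≤ c) : ∃ y, Tendsto x l (𝓝 y) := by
  have hK : IsCompact (Set.Icc (fun _ : r => -c) fun _ => c) := isCompact_Icc
  obtain ⟨y, -, hy⟩ := hK.ultrafilter_le_nhds (l.map x) (by
    refine le_principal_iff.2 (h.mono fun i hi => ?_)
    exact ⟨fun a => (abs_le.1 (hi a)).1, fun a => (abs_le.1 (hi a)).2⟩)
  exact ⟨y, hy⟩

/-- The objective function `N gᵀ G(C) g`. -/
def objective (G : Matrix r r ℝ → Matrix r r ℝ) (N : ι → ℕ) (g : ι → (Fin q → ℝ) → r → ℝ)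
    (C : ι → (Fin q → ℝ) → Matrix r r ℝ) (i : ι) (β : Fin q → ℝ) : ℝ :=
  N i * (g i β ⬝ᵥ (G (C i β) *ᵥ g i β))

namespace ScoreLimit

variable {l : Filter ι} {N : ι → ℕ} {g : ι → (Fin q → ℝ) → r → ℝ}
  {C : ι → (Fin q → ℝ) → Matrix r r ℝ} {B : Set (Fin q → ℝ)} {β₀ : Fin q → ℝ}
  {V : (Fin q → ℝ) → Matrix r r ℝ} {D₀ : Matrix r (Fin q) ℝ} {ξ : r → ℝ}
  {G : Matrix r r ℝ → Matrix r r ℝ} {x : ι → Fin q → ℝ} {y : Fin q → ℝ}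

lemma tendsto_sqrt_size (H : ScoreLimit l N g C B β₀ V D₀ ξ) :
    Tendsto (fun i => √(N i : ℝ)) l atTop :=
  Real.tendsto_sqrt_atTop.comp (tendsto_natCast_atTop_atTop.comp H.size)

lemma size_pos (H : ScoreLimit l N g C B β₀ V D₀ ξ) : ∀ᶠ i in l, 0 < √(N i : ℝ) :=
  H.tendsto_sqrt_size.eventually_gt_atTop 0

lemma mem (H : ScoreLimit l N g C B β₀ V D₀ ξ) : β₀ ∈ B := interior_subset H.true_mem

lemma tendsto_moment (H : ScoreLimit l N g C B β₀ V D₀ ξ) (hy : y ∈ B)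
    (hx : Tendsto x l (𝓝 y)) (hxB : ∀ᶠ i in l, x i ∈ B) :
    Tendsto (fun i => C i (x i)) l (𝓝 (V y)) :=
  tendsto_pi_nhds.2 fun a => tendsto_pi_nhds.2 fun b =>
    tendsto_comp_of_uniformlyOn (H.moment a b) (H.moment_cont a b) hy hx hxB

/-- The mean value theorem holds only coordinatewise, so each row of `M i` is a gradient at its own
intermediate point. All these points are squeezed to `β₀`, and uniform convergence of the
derivatives gives the limit of `M`. -/
lemma exists_expansion (H : ScoreLimit l N g C B β₀ V D₀ ξ) (hx : Tendsto x l (𝓝 β₀)) :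
    ∃ M : ι → Matrix r (Fin q) ℝ, Tendsto M l (𝓝 D₀) ∧
      ∀ᶠ i in l, g i (x i) = g i β₀ + M i *ᵥ (x i - β₀) := by
  obtain ⟨K, hK, hconv, hdiff, D, hD, hDc, hD₀⟩ := H.exists_deriv
  have hβK : β₀ ∈ K := mem_of_mem_nhds hK
  have key : ∀ a, ∃ c : ι → Fin q → ℝ, (∀ i, c i ∈ segment ℝ β₀ (x i)) ∧ ∀ᶠ i in l,
      c i ∈ K ∧ g i (x i) a = g i β₀ a + ∑ j, partialDeriv (fun b => g i b a) j (c i) *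
        (x i - β₀) j := by
    intro a
    have : ∀ i, ∃ c, c ∈ segment ℝ β₀ (x i) ∧ (x i ∈ K →
        (∀ a, ∀ β ∈ K, DifferentiableAt ℝ (fun b => g i b a) β) →
        c ∈ K ∧ g i (x i) a = g i β₀ a + ∑ j, partialDeriv (fun b => g i b a) j c *
        (x i - β₀) j) := by
      intro i
      by_cases h : x i ∈ K ∧ (∀ a, ∀ β ∈ K, DifferentiableAt ℝ (fun b => g i b a) β)
      · obtain ⟨c, hc, hc'⟩ := domain_mvt (f := fun b => g i b a)
          (fun z hz => (h.2 a z hz).hasFDerivAt.hasFDerivWithinAt) hconv hβK h.1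
        refine ⟨c, hc, fun _ _ => ⟨hconv.segment_subset hβK h.1 hc, ?_⟩⟩
        rw [← fderiv_apply_eq_sum, ← hc']
        ring
      -- The default `β₀` keeps the intermediate point on the segment for every `i`, so that its
      -- distance to `β₀` is controlled everywhere.
      · exact ⟨β₀, left_mem_segment ℝ _ _, fun h1 h2 => absurd ⟨h1, h2⟩ h⟩
    choose c hc hc' using this
    refine ⟨c, hc, ?_⟩
    filter_upwards [hdiff, hx.eventually hK] with i h1 h2 using hc' i h2 h1
  choose c hc hc' using key
  refine ⟨fun i => Matrix.of fun a j => partialDeriv (fun b => g i b a) j (c a i), ?_, ?_⟩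
  · refine tendsto_pi_nhds.2 fun a => tendsto_pi_nhds.2 fun j => ?_
    rw [← hD₀]
    refine tendsto_comp_of_uniformlyOn (hD a j) (hDc a j) hβK ?_ ((hc' a).mono fun i hi => hi.1)
    rw [tendsto_iff_dist_tendsto_zero] at hx ⊢
    refine squeeze_zero (fun _ => dist_nonneg) (fun i => ?_) hx
    have := segment_subset_closedBall_left β₀ (x i) (hc a i)
    simpa [dist_comm] using this
  · filter_upwards [eventually_all.2 hc'] with i hi
    ext a
    rw [(hi a).2]
    rfl

variable [DecidableEq r]

/-- The determinants have a nonzero limit, and a nonsingular positive semidefinite matrix is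
positive definite. From then on the generalized inverse is the inverse. -/
lemma eventually_posDef (H : ScoreLimit l N g C B β₀ V D₀ ξ) (hy : y ∈ B)
    (hx : Tendsto x l (𝓝 y)) (hxB : ∀ᶠ i in l, x i ∈ B) :
    ∀ᶠ i in l, (C i (x i)).PosDef := by
  have h1 : Tendsto (fun i => (C i (x i)).det) l (𝓝 (V y).det) :=
    ((continuous_id.matrix_det).tendsto (V y)).comp (H.tendsto_moment hy hx hxB)
  filter_upwards [h1.eventually_ne (H.posDef y hy).det_pos.ne'] with i hi
  exact (H.posSemidef i _).posDef_iff_isUnit.2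
    ((Matrix.isUnit_iff_isUnit_det _).2 (isUnit_iff_ne_zero.2 hi))

lemma tendsto_inv_moment (H : ScoreLimit l N g C B β₀ V D₀ ξ) (hG : IsGenInverse G) (hy : y ∈ B)
    (hx : Tendsto x l (𝓝 y)) (hxB : ∀ᶠ i in l, x i ∈ B) :
    Tendsto (fun i => G (C i (x i))) l (𝓝 (V y)⁻¹) := by
  refine (tendsto_matrix_inv (H.tendsto_moment hy hx hxB)
    (H.posDef y hy).det_pos.ne').congr' ?_
  filter_upwards [H.eventually_posDef hy hx hxB] with i hi
  exact (genInverse_eq_inv hG hi.det_pos.ne').symm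

lemma tendsto_objective (H : ScoreLimit l N g C B β₀ V D₀ ξ) (hG : IsGenInverse G) (hy : y ∈ B)
    (hx : Tendsto x l (𝓝 y)) (hxB : ∀ᶠ i in l, x i ∈ B) {w : r → ℝ}
    (hw : Tendsto (fun i => √(N i : ℝ) • g i (x i)) l (𝓝 w)) :
    Tendsto (fun i => objective G N g C i (x i)) l (𝓝 (w ⬝ᵥ ((V y)⁻¹ *ᵥ w))) := by
  refine (tendsto_dotProduct hw (tendsto_mulVec (H.tendsto_inv_moment hG hy hx hxB) hw)).congr
    fun i => ?_
  simp only [objective, Matrix.mulVec_smul, smul_dotProduct, dotProduct_smul, smul_eq_mul]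
  rw [← mul_assoc, Real.mul_self_sqrt (Nat.cast_nonneg _)]

/-- By compactness the ultrafilter has some limit `y` in `B`. Divided by N, the objective at `x i`
tends to γ(y)ᵀV(y)⁻¹γ(y), while at the truth it tends to 0, because the undivided objective
converges there. Hence γ(y) = 0, and identifiability gives `y = β₀`. -/
lemma tendsto_argMin {l : Ultrafilter ι} (H : ScoreLimit l N g C B β₀ V D₀ ξ)
    (hG : IsGenInverse G) (hxB : ∀ᶠ i in l, x i ∈ B)
    (hle : ∀ᶠ i in l, objective G N g C i (x i) ≤ objective G N g C i β₀) :
    Tendsto x l (𝓝 β₀) := by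
  obtain ⟨y, hy, hx⟩ := H.isCompact.ultrafilter_le_nhds (l.map x) (le_principal_iff.2 hxB)
  change Tendsto x l (𝓝 y) at hx
  obtain ⟨γ, hγ, hγc, hid⟩ := H.exists_mean
  have hg : Tendsto (fun i => g i (x i)) l (𝓝 fun a => γ a y) :=
    tendsto_pi_nhds.2 fun a => tendsto_comp_of_uniformlyOn (hγ a) (hγc a) hy hx hxB
  have h1 := tendsto_dotProduct hg (tendsto_mulVec (H.tendsto_inv_moment hG hy hx hxB) hg)
  have h2 := H.tendsto_objective hG H.mem tendsto_const_nhds (.of_forall fun _ => H.mem) H.score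
  have hNinv : Tendsto (fun i => ((N i : ℝ))⁻¹) l (𝓝 0) :=
    tendsto_inv_atTop_zero.comp (tendsto_natCast_atTop_atTop.comp H.size)
  have h3 := hNinv.mul h2
  rw [zero_mul] at h3
  have h4 : (fun a => γ a y) ⬝ᵥ ((V y)⁻¹ *ᵥ fun a => γ a y) ≤ 0 := by
    refine le_of_tendsto_of_tendsto h1 h3 ?_
    filter_upwards [hle, H.size_pos] with i hi hN
    have hN' : (0 : ℝ) < N i := Real.sqrt_pos.1 hN
    rw [inv_mul_eq_div, le_div_iff₀' hN']
    exact hi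
  have h5 : (fun a => γ a y) = 0 := by
    by_contra hne
    exact absurd h4 (not_le.2 (quadForm_pos (H.posDef y hy).inv hne))
  rwa [hid y hy fun a => congrFun h5 a] at hx

/-- A parameter sequence whose objective is at most the one at the truth is `√N`-consistent. -/
lemma exists_tendsto_rescaled {l : Ultrafilter ι} (H : ScoreLimit l N g C B β₀ V D₀ ξ)
    (hG : IsGenInverse G) (hJ : (D₀ᵀ * (V β₀)⁻¹ * D₀).PosDef) (hxB : ∀ᶠ i in l, x i ∈ B)
    (hle : ∀ᶠ i in l, objective G N g C i (x i) ≤ objective G N g C i β₀) :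
    ∃ u : Fin q → ℝ, Tendsto (fun i => √(N i : ℝ) • (x i - β₀)) l (𝓝 u) := by
  have hx := H.tendsto_argMin hG hxB hle
  have hC := H.tendsto_moment H.mem hx hxB
  have h2 := H.tendsto_objective hG H.mem tendsto_const_nhds (.of_forall fun _ => H.mem) H.score
  set c := ξ ⬝ᵥ ((V β₀)⁻¹ *ᵥ ξ)
  -- The objective at `x i` is at most the one at the truth, hence eventually below `c + 1`. With
  -- `m` bounding the diagonal of the moment matrix, `sq_apply_le` bounds the normalized scores, so
  -- they converge along the ultrafilter.
  obtain ⟨w, hw⟩ : ∃ w, Tendsto (fun i => √(N i : ℝ) • g i (x i)) l (𝓝 w) := by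
    obtain ⟨m, hm⟩ : ∃ m : ℝ, ∀ a, V β₀ a a < m :=
      ⟨1 + ∑ a, |V β₀ a a|, fun a => by
        have := Finset.single_le_sum (f := fun a => |V β₀ a a|) (fun _ _ => abs_nonneg _)
          (Finset.mem_univ a)
        linarith [le_abs_self (V β₀ a a)]⟩
    have hc : ∀ a, ∀ᶠ i in (l : Filter ι), C i (x i) a a < m := fun a =>
      ((tendsto_pi_nhds.1 (tendsto_pi_nhds.1 hC a) a)).eventually_lt_const (hm a)
    refine Ultrafilter.exists_tendsto_of_bounded (c := √(m * (c + 1))) ?_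
    filter_upwards [eventually_all.2 hc, h2.eventually_lt_const (lt_add_one c), hle,
      H.eventually_posDef H.mem hx hxB] with i h3 h4 h5 h6 a
    apply Real.abs_le_sqrt
    have h7 := sq_apply_le h6 (√(N i : ℝ) • g i (x i)) a
    have h8 : (√(N i : ℝ) • g i (x i)) ⬝ᵥ ((C i (x i))⁻¹ *ᵥ (√(N i : ℝ) • g i (x i))) =
        objective G N g C i (x i) := by
      rw [objective, genInverse_eq_inv hG h6.det_pos.ne']
      simp only [Matrix.mulVec_smul, smul_dotProduct, dotProduct_smul, smul_eq_mul]
      rw [← mul_assoc, Real.mul_self_sqrt (Nat.cast_nonneg _)]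
    have h9 : 0 ≤ objective G N g C i (x i) := by
      rw [← h8]; exact quadForm_nonneg h6.inv.posSemidef _
    rw [h8] at h7
    refine h7.trans (mul_le_mul (h3 a).le (by linarith) h9 ?_)
    exact h6.diag_pos.le.trans (h3 a).le
  obtain ⟨M, hM, hMx⟩ := H.exists_expansion hx
  have hMt : Tendsto (fun i => (M i)ᵀ) l (𝓝 D₀ᵀ) :=
    ((continuous_id.matrix_transpose).tendsto D₀).comp hM
  have hMM : Tendsto (fun i => (M i)ᵀ * M i) l (𝓝 (D₀ᵀ * D₀)) :=
    (((continuous_fst.matrix_mul continuous_snd).tendsto (D₀ᵀ, D₀)).comp (hMt.prodMk_nhds hM))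
  have hinj : Function.Injective D₀.mulVec := by
    refine (injective_iff_map_eq_zero D₀.mulVecLin).2 fun v hv => ?_
    rw [Matrix.mulVecLin_apply] at hv
    by_contra hne
    have := quadForm_pos hJ hne
    rw [← Matrix.mulVec_mulVec, hv, Matrix.mulVec_zero, dotProduct_zero] at this
    exact lt_irrefl _ this
  have hdet : (D₀ᵀ * D₀).det ≠ 0 := by
    have := Matrix.PosDef.conjTranspose_mul_self D₀ hinj
    rw [Matrix.conjTranspose_eq_transpose_of_trivial] at this
    exact this.det_pos.ne'
  have hdet' : ∀ᶠ i in (l : Filter ι), ((M i)ᵀ * M i).det ≠ 0 :=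
    (((continuous_id.matrix_det).tendsto _).comp hMM).eventually_ne hdet
  -- The expansion reads M √N(x - β₀) = √N g(x) - √N g(β₀). Since `D₀` is injective, the normal
  -- equations solve it for the rescaled parameter.
  refine ⟨(D₀ᵀ * D₀)⁻¹ *ᵥ (D₀ᵀ *ᵥ (w - ξ)), Tendsto.congr' ?_
    (tendsto_mulVec (tendsto_matrix_inv hMM hdet) (tendsto_mulVec hMt (hw.sub H.score)))⟩
  filter_upwards [hMx, hdet'] with i h1 h3
  rw [← smul_sub, h1, add_sub_cancel_left, ← Matrix.mulVec_smul, Matrix.mulVec_mulVec _ (M i)ᵀ,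
    Matrix.mulVec_mulVec, Matrix.nonsing_inv_mul _ (isUnit_iff_ne_zero.2 h3), Matrix.one_mulVec]

/-- Along a `√N`-convergent parameter sequence the objective converges to its quadratic
approximation. -/
lemma tendsto_objective_rescaled (H : ScoreLimit l N g C B β₀ V D₀ ξ) (hG : IsGenInverse G)
    {u : Fin q → ℝ} (hu : Tendsto (fun i => √(N i : ℝ) • (x i - β₀)) l (𝓝 u)) :
    Tendsto (fun i => objective G N g C i (x i)) l
      (𝓝 ((ξ + D₀ *ᵥ u) ⬝ᵥ ((V β₀)⁻¹ *ᵥ (ξ + D₀ *ᵥ u)))) := by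
  have hx : Tendsto x l (𝓝 β₀) := by
    have h1 := (tendsto_inv_atTop_zero.comp H.tendsto_sqrt_size).smul hu
    rw [zero_smul] at h1
    have h2 : Tendsto (fun i => x i - β₀) l (𝓝 0) := by
      refine h1.congr' ?_
      filter_upwards [H.size_pos] with i hi
      rw [Function.comp_apply, smul_smul, inv_mul_cancel₀ hi.ne', one_smul]
    simpa using h2.add_const β₀
  have hxB : ∀ᶠ i in l, x i ∈ B := hx.eventually (mem_interior_iff_mem_nhds.1 H.true_mem)
  obtain ⟨M, hM, hMx⟩ := H.exists_expansion hx
  refine H.tendsto_objective hG H.mem hx hxB ((H.score.add (tendsto_mulVec hM hu)).congr' ?_)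
  filter_upwards [hMx] with i hi
  rw [hi, smul_add, Matrix.mulVec_smul]

/-- The rescaled minimizers converge to some `u` with Lᵀu = 0, so the limiting value is at least the
constrained minimum. The feasible competitors β₀ + v/√N, with `v` the minimizer of the limiting
quadratic, give the reverse inequality. An empty index type `k` is allowed and covers unrestricted
minimization. -/
theorem tendsto_objective_argMin [Fintype k] [DecidableEq k] {l : Ultrafilter ι}
    (H : ScoreLimit l N g C B β₀ V D₀ ξ) (hG : IsGenInverse G)
    (hJ : (D₀ᵀ * (V β₀)⁻¹ * D₀).PosDef) {L : Matrix (Fin q) k ℝ}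
    (hL : Function.Injective L.mulVec) {b : k → ℝ} (hb : Lᵀ *ᵥ β₀ = b)
    (hmin : ∀ᶠ i in l, IsArgMin (objective G N g C i) {β ∈ B | Lᵀ *ᵥ β = b} (x i)) :
    Tendsto (fun i => objective G N g C i (x i)) l (𝓝 (constrainedMin (V β₀) D₀ L ξ)) := by
  have hxB : ∀ᶠ i in l, x i ∈ B := hmin.mono fun i hi => hi.1.1
  obtain ⟨u, hu⟩ := H.exists_tendsto_rescaled hG hJ hxB
    (hmin.mono fun i hi => isMinOn_iff.1 hi.2 β₀ ⟨H.mem, hb⟩)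
  have hQ := H.tendsto_objective_rescaled hG hu
  obtain ⟨v, hv, hmv⟩ := exists_constrained_minimizer (H.posDef _ H.mem) hJ hL ξ
  have hLu : Lᵀ *ᵥ u = 0 := by
    refine tendsto_nhds_unique (tendsto_mulVec (tendsto_const_nhds (x := Lᵀ)) hu)
      (tendsto_const_nhds.congr' ?_)
    filter_upwards [hmin] with i hi
    rw [Matrix.mulVec_smul, Matrix.mulVec_sub, hi.1.2, hb, sub_self, smul_zero]
  set x' : ι → Fin q → ℝ := fun i => β₀ + (√(N i : ℝ))⁻¹ • v with hx'
  have hv' : Tendsto (fun i => √(N i : ℝ) • (x' i - β₀)) l (𝓝 v) := by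
    refine tendsto_const_nhds.congr' ?_
    filter_upwards [H.size_pos] with i hi
    rw [hx', add_sub_cancel_left, smul_smul, mul_inv_cancel₀ hi.ne', one_smul]
  have hQ' := H.tendsto_objective_rescaled hG hv'
  have hx'B : ∀ᶠ i in l, x' i ∈ B := by
    have h1 : Tendsto x' l (𝓝 (β₀ + (0 : ℝ) • v)) :=
      ((tendsto_inv_atTop_zero.comp H.tendsto_sqrt_size).smul_const v).const_add β₀
    rw [zero_smul, add_zero] at h1
    exact h1.eventually (mem_interior_iff_mem_nhds.1 H.true_mem)
  have hle := le_of_tendsto_of_tendsto hQ hQ' (by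
    filter_upwards [hmin, hx'B] with i hi hi'
    refine hi.2 ⟨hi', ?_⟩
    rw [hx', Matrix.mulVec_add, Matrix.mulVec_smul, hv, smul_zero, add_zero, hb])
  rw [hmv v hv, hmv u hLu, sub_self, zero_dotProduct, add_zero] at hle
  have hnn := quadForm_nonneg hJ.posSemidef (u - v)
  rw [hmv u hLu] at hQ
  convert hQ using 2
  linarith

end ScoreLimit

end Deterministic

/-! ### Differentiating a quadratic form in an inverse matrix. -/

section Gradient

variable {r : Type*} [Fintype r] [DecidableEq r] {q : ℕ}

/-- The first factor is O(y - x) and the second is o(1). As the second need only be continuous, the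
matrix inverse never has to be differentiated. -/
lemma hasFDerivAt_mul_zero {E : Type*} [NormedAddCommGroup E] [NormedSpace ℝ E] {f g : E → ℝ}
    {x : E} (hf : DifferentiableAt ℝ f x) (hfx : f x = 0) (hg : ContinuousAt g x) (hgx : g x = 0) :
    HasFDerivAt (fun y => f y * g y) (0 : E →L[ℝ] ℝ) x := by
  rw [hasFDerivAt_iff_isLittleO]
  have h1 : f =O[𝓝 x] fun y => y - x := by simpa [hfx] using hf.isBigO_sub
  have h2 : g =o[𝓝 x] fun _ => (1 : ℝ) := by
    rw [Asymptotics.isLittleO_one_iff]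
    simpa [hgx] using hg.tendsto
  have h3 := h1.norm_right.mul_isLittleO h2
  simp only [mul_one] at h3
  simpa [hfx] using h3.norm_right

/-- The derivative of a quadratic form in the inverse of a matrix, in terms of `x₀ = C⁻¹ g`. -/
lemma hasFDerivAt_quadForm_inv {g : (Fin q → ℝ) → r → ℝ} {C : (Fin q → ℝ) → Matrix r r ℝ}
    {β : Fin q → ℝ} (hg : ∀ a, DifferentiableAt ℝ (fun b => g b a) β)
    (hC : ∀ a c, DifferentiableAt ℝ (fun b => C b a c) β) (hsymm : ∀ b, (C b)ᵀ = C b)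
    (hdet : (C β).det ≠ 0) {G : Matrix r r ℝ → Matrix r r ℝ} (hG : IsGenInverse G) :
    HasFDerivAt (fun b => g b ⬝ᵥ (G (C b) *ᵥ g b))
      ((2 : ℝ) • ∑ a, ((C β)⁻¹ *ᵥ g β) a • fderiv ℝ (fun b => g b a) β -
        ∑ a, ∑ c, (((C β)⁻¹ *ᵥ g β) a * ((C β)⁻¹ *ᵥ g β) c) • fderiv ℝ (fun b => C b a c) β) β := by
  set x₀ := (C β)⁻¹ *ᵥ g β with hx₀
  have hCc : Tendsto C (𝓝 β) (𝓝 (C β)) :=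
    tendsto_pi_nhds.2 fun a => tendsto_pi_nhds.2 fun c => (hC a c).continuousAt
  have hCi : Tendsto (fun b => (C b)⁻¹) (𝓝 β) (𝓝 (C β)⁻¹) := tendsto_matrix_inv hCc hdet
  have hdet' : ∀ᶠ b in 𝓝 β, (C b).det ≠ 0 :=
    (((continuous_id.matrix_det).tendsto _).comp hCc).eventually_ne hdet
  -- Near `β` one has exactly gᵀC⁻¹g = 2x₀ᵀg - x₀ᵀCx₀ + RᵀC⁻¹R. The first two terms are linear in g
  -- and C, and the last has zero derivative because `R` vanishes at `β`.
  set R : (Fin q → ℝ) → r → ℝ := fun b => g b - C b *ᵥ x₀ with hR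
  have hRdiff : ∀ a, DifferentiableAt ℝ (fun b => R b a) β := fun a => by
    simp only [hR, Pi.sub_apply, Matrix.mulVec, dotProduct]
    exact (hg a).sub (DifferentiableAt.fun_sum fun c _ => (hC a c).mul_const _)
  have hR0 : R β = 0 := by
    simp only [hR, hx₀]
    rw [Matrix.mulVec_mulVec, Matrix.mul_nonsing_inv _ (isUnit_iff_ne_zero.2 hdet),
      Matrix.one_mulVec, sub_self]
  have hRc : Tendsto R (𝓝 β) (𝓝 (R β)) :=
    tendsto_pi_nhds.2 fun a => (hRdiff a).continuousAt
  have hrem : HasFDerivAt (fun b => R b ⬝ᵥ ((C b)⁻¹ *ᵥ R b)) (0 : (Fin q → ℝ) →L[ℝ] ℝ) β := by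
    have hc : ∀ a, ContinuousAt (fun b => ((C b)⁻¹ *ᵥ R b) a) β := fun a =>
      tendsto_pi_nhds.1 (tendsto_mulVec hCi hRc) a
    have := HasFDerivAt.fun_sum (u := Finset.univ) fun a (_ : a ∈ Finset.univ) =>
      hasFDerivAt_mul_zero (hRdiff a) (by rw [hR0]; rfl) (hc a)
        (by rw [hR0, Matrix.mulVec_zero]; rfl)
    simpa [dotProduct] using this
  have hlin : HasFDerivAt (fun b => 2 * ∑ a, x₀ a * g b a)
      ((2 : ℝ) • ∑ a, x₀ a • fderiv ℝ (fun b => g b a) β) β :=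
    (HasFDerivAt.fun_sum fun a _ => (hg a).hasFDerivAt.const_mul (x₀ a)).const_mul 2
  have hquad : HasFDerivAt (fun b => ∑ a, ∑ c, (x₀ a * x₀ c) * C b a c)
      (∑ a, ∑ c, (x₀ a * x₀ c) • fderiv ℝ (fun b => C b a c) β) β :=
    HasFDerivAt.fun_sum fun a _ => HasFDerivAt.fun_sum fun c _ =>
      (hC a c).hasFDerivAt.const_mul (x₀ a * x₀ c)
  have := (hlin.sub hquad).add hrem
  rw [add_zero] at this
  refine this.congr_of_eventuallyEq ?_
  filter_upwards [hdet'] with b hb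
  have hbu := isUnit_iff_ne_zero.2 hb
  have hsi : ((C b)⁻¹)ᵀ = (C b)⁻¹ := by rw [Matrix.transpose_nonsing_inv, hsymm]
  have e1 : (C b)⁻¹ *ᵥ (C b *ᵥ x₀) = x₀ := by
    rw [Matrix.mulVec_mulVec, Matrix.nonsing_inv_mul _ hbu, Matrix.one_mulVec]
  have e2 : (C b *ᵥ x₀) ⬝ᵥ ((C b)⁻¹ *ᵥ g b) = x₀ ⬝ᵥ g b := by
    rw [dotProduct_mulVec_comm hsi, e1, dotProduct_comm]
  have e3 : ∑ a, ∑ c, (x₀ a * x₀ c) * C b a c = x₀ ⬝ᵥ (C b *ᵥ x₀) := by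
    simp only [dotProduct, Matrix.mulVec, Finset.mul_sum]
    exact Finset.sum_congr rfl fun a _ => Finset.sum_congr rfl fun c _ => by ring
  have e4 : ∑ a, x₀ a * g b a = x₀ ⬝ᵥ g b := rfl
  rw [genInverse_eq_inv hG hb]
  simp only [Pi.add_apply, Pi.sub_apply, e3, e4, hR, Matrix.mulVec_sub, sub_dotProduct,
    dotProduct_sub, e1, e2]
  rw [dotProduct_comm (g b) x₀, dotProduct_comm (C b *ᵥ x₀) x₀]
  ring

end Gradient

/-! ### Convergence in probability as convergence along a filter. -/

section ProbFilter

variable {Ω : Type*} [MeasurableSpace Ω]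

/-- The filter of the events whose probability tends to one: a sequence of random variables tends
to a constant along it iff it does so in probability. -/
def probFilter (P : Measure Ω) : Filter (ℕ × Ω) where
  sets := {A | Tendsto (fun N => P {ω | (N, ω) ∉ A}) atTop (𝓝 0)}
  univ_sets := by simp
  sets_of_superset {A A'} hA hAA' := by
    refine tendsto_of_tendsto_of_tendsto_of_le_of_le tendsto_const_nhds hA (fun _ => zero_le)
      fun N => measure_mono fun ω hω h => hω (hAA' h)
  inter_sets {A A'} hA hA' := by
    have := Tendsto.add hA hA'
    rw [add_zero] at this
    refine tendsto_of_tendsto_of_tendsto_of_le_of_le tendsto_const_nhds this (fun _ => zero_le)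
      fun N => (measure_mono fun ω hω => ?_).trans (measure_union_le _ _)
    by_contra h
    simp only [Set.mem_union, Set.mem_ofPred_eq, not_or, not_not] at h
    exact hω h

variable {P : Measure Ω}

lemma eventually_probFilter {p : ℕ × Ω → Prop} :
    (∀ᶠ x in probFilter P, p x) ↔ Tendsto (fun N => P {ω | ¬ p (N, ω)}) atTop (𝓝 0) := Iff.rfl

lemma eventually_probFilter_of_ae {p : ℕ × Ω → Prop} (h : ∀ N, ∀ᵐ ω ∂P, p (N, ω)) :
    ∀ᶠ x in probFilter P, p x := by
  rw [eventually_probFilter]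
  have : ∀ N, P {ω | ¬ p (N, ω)} = 0 := fun N => ae_iff.1 (h N)
  simp [this]

lemma tendsto_fst_probFilter : Tendsto Prod.fst (probFilter P) atTop := by
  refine tendsto_atTop.2 fun n => eventually_probFilter.2 ?_
  refine tendsto_const_nhds.congr' ?_
  filter_upwards [eventually_ge_atTop n] with N hN
  simp [hN]

lemma tendstoInMeasure_iff_probFilter {E : Type*} [PseudoMetricSpace E] {f : ℕ → Ω → E} {c : E} :
    TendstoInMeasure P f atTop (fun _ => c) ↔
      Tendsto (fun x : ℕ × Ω => f x.1 x.2) (probFilter P) (𝓝 c) := by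
  rw [tendstoInMeasure_iff_dist, Metric.tendsto_nhds]
  refine forall₂_congr fun ε _ => ?_
  rw [eventually_probFilter]
  simp

/-- A tight sequence may be assumed bounded when proving convergence in probability. -/
lemma tendsto_probFilter_of_tight {α : Type*} {f : ℕ × Ω → α} {lim : Filter α} {b : ℕ × Ω → ℝ}
    (hb : ∀ ε : ENNReal, 0 < ε → ∃ c, ∀ N, P {ω | c < b (N, ω)} ≤ ε)
    (h : ∀ c, Tendsto f (probFilter P ⊓ 𝓟 {x | b x ≤ c}) lim) : Tendsto f (probFilter P) lim := by
  intro A hA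
  refine eventually_probFilter.2 (ENNReal.tendsto_nhds_zero.2 fun ε hε => ?_)
  obtain ⟨c, hc⟩ := hb (ε / 2) (ENNReal.half_pos hε.ne')
  have h1 := eventually_inf_principal.1 ((h c).eventually hA)
  rw [eventually_probFilter, ENNReal.tendsto_nhds_zero] at h1
  filter_upwards [h1 (ε / 2) (ENNReal.half_pos hε.ne')] with N hN
  calc P {ω | ¬ f (N, ω) ∈ A}
      ≤ P ({ω | c < b (N, ω)} ∪ {ω | ¬ ((N, ω) ∈ {x | b x ≤ c} → f (N, ω) ∈ A)}) := by
        refine measure_mono fun ω hω => ?_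
        by_cases hbc : c < b (N, ω)
        · exact Or.inl hbc
        · exact Or.inr fun h => hω (h (not_lt.1 hbc))
    _ ≤ ε / 2 + ε / 2 := (measure_union_le _ _).trans (add_le_add (hc N) hN)
    _ = ε := ENNReal.add_halves ε

end ProbFilter

/-! ### Laws of large numbers, tightness and the central limit theorem for an i.i.d. sample. -/

section Sample

variable {𝓩 Ω : Type*} [MeasurableSpace 𝓩] [MeasurableSpace Ω] {F : Measure 𝓩}
  {P : Measure Ω} {ζ : ℕ → Ω → 𝓩}

lemma ae_of_hasLaw (hlaw : ∀ i, HasLaw (ζ i) F P) {p : 𝓩 → Prop} (hp : ∀ᵐ z ∂F, p z) :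
    ∀ᵐ ω ∂P, ∀ i, p (ζ i ω) :=
  ae_all_iff.2 fun i => ae_of_ae_map (hlaw i).aemeasurable (by rwa [(hlaw i).map_eq])

lemma aemeasurable_comp_hasLaw {E : Type*} [MeasurableSpace E] (hlaw : ∀ i, HasLaw (ζ i) F P)
    {f : 𝓩 → E} (hf : AEMeasurable f F) (i : ℕ) : AEMeasurable (fun ω => f (ζ i ω)) P :=
  AEMeasurable.comp_aemeasurable (by rwa [(hlaw i).map_eq]) (hlaw i).aemeasurable

lemma identDistrib_comp {E : Type*} [MeasurableSpace E] (hlaw : ∀ i, HasLaw (ζ i) F P)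
    {f : 𝓩 → E} (hf : AEMeasurable f F) (i : ℕ) :
    IdentDistrib (fun ω => f (ζ i ω)) (fun ω => f (ζ 0 ω)) P P :=
  ((hlaw i).identDistrib (hlaw 0)).comp_of_aemeasurable (by rwa [(hlaw i).map_eq])

lemma iIndepFun_comp {E : Type*} [MeasurableSpace E] (hlaw : ∀ i, HasLaw (ζ i) F P)
    (hindep : iIndepFun ζ P) {f : 𝓩 → E} (hf : AEMeasurable f F) :
    iIndepFun (fun i ω => f (ζ i ω)) P :=
  hindep.comp₀ (fun _ => f) (fun i => (hlaw i).aemeasurable) fun i => by rwa [(hlaw i).map_eq]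

lemma integral_comp_hasLaw {E : Type*} [NormedAddCommGroup E] [NormedSpace ℝ E]
    (hlaw : ∀ i, HasLaw (ζ i) F P) {f : 𝓩 → E} (hf : AEStronglyMeasurable f F) (i : ℕ) :
    ∫ ω, f (ζ i ω) ∂P = ∫ z, f z ∂F := (hlaw i).integral_comp hf

lemma integrable_comp_hasLaw {E : Type*} [NormedAddCommGroup E]
    (hlaw : ∀ i, HasLaw (ζ i) F P) {f : 𝓩 → E} (hf : Integrable f F) (i : ℕ) :
    Integrable (fun ω => f (ζ i ω)) P :=
  Integrable.comp_aemeasurable (by rwa [(hlaw i).map_eq]) (hlaw i).aemeasurable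

/-- **Uniform law of large numbers** over a compact set. -/
theorem uniform_law_of_large_numbers [IsProbabilityMeasure P] {α : Type*} [MetricSpace α]
    (hlaw : ∀ i, HasLaw (ζ i) F P) (hindep : iIndepFun ζ P) {K : Set α} (hK : IsCompact K)
    {f : 𝓩 → α → ℝ} (hcont : ∀ᵐ z ∂F, ContinuousOn (f z) K)
    (hmeas : ∀ x ∈ K, AEMeasurable (fun z => f z x) F) {H : 𝓩 → ℝ} (hH : Integrable H F)
    (hfH : ∀ᵐ z ∂F, ∀ x ∈ K, |f z x| ≤ H z) :
    TendstoUniformlyOn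
      (fun (y : ℕ × Ω) x => (y.1 : ℝ)⁻¹ * ∑ i ∈ Finset.range y.1, f (ζ i y.2) x)
      (fun x => ∫ z, f z x ∂F) (probFilter P) K ∧
    ContinuousOn (fun x => ∫ z, f z x ∂F) K := by
  classical
  have : CompactSpace K := isCompact_iff_compactSpace.1 hK
  let : MeasurableSpace C(K, ℝ) := borel _
  have : BorelSpace C(K, ℝ) := ⟨rfl⟩
  -- The function `f z` becomes a random element of the Banach space C(K, ℝ), whose strong law is
  -- uniform convergence on `K`. The value 0 is used only on the null set where `f z` is not
  -- continuous on `K`.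
  set Φ : 𝓩 → C(K, ℝ) := fun z =>
    if h : ContinuousOn (f z) K then ⟨K.domRestrict (f z), h.domRestrict⟩ else 0 with hΦ
  have hΦf : ∀ᵐ z ∂F, ∀ x : K, Φ z x = f z x := by
    filter_upwards [hcont] with z hz x
    simp only [hΦ, hz, dif_pos]
    rfl
  have hΦm : AEMeasurable Φ F := by
    obtain ⟨s, hs, hsd⟩ := TopologicalSpace.exists_countable_dense K
    have : Countable s := hs.to_subtype
    let e : C(K, ℝ) → (s → ℝ) := fun φ x => φ x
    have he : Continuous e := continuous_pi fun x => ContinuousEvalConst.continuous_eval_const _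
    have hinj : Function.Injective e := fun φ ψ h => by
      refine DFunLike.coe_injective (Continuous.ext_on hsd φ.continuous ψ.continuous ?_)
      intro x hx
      exact congrFun h ⟨x, hx⟩
    -- Restriction to a countable dense set is a continuous injection between Polish spaces, hence a
    -- measurable embedding. Its measurable left inverse recovers `Φ` from countably many measurable
    -- evaluations.
    obtain ⟨e', he', hee⟩ := (he.measurableEmbedding hinj).exists_measurable_extend
      measurable_id fun _ => ⟨0⟩
    have h1 : AEMeasurable (fun z => e (Φ z)) F := by
      refine aemeasurable_pi_iff.2 fun x => (hmeas x.1 x.1.2).congr ?_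
      filter_upwards [hΦf] with z hz
      exact (hz x.1).symm
    have h2 : Φ = fun z => e' (e (Φ z)) := funext fun z => (congrFun hee (Φ z)).symm
    rw [h2]
    exact he'.comp_aemeasurable h1
  have hΦi : Integrable Φ F := by
    refine hH.norm.mono' hΦm.aestronglyMeasurable ?_
    filter_upwards [hΦf, hfH] with z h1 h2
    refine (ContinuousMap.norm_le _ (norm_nonneg _)).2 fun x => ?_
    rw [h1 x]
    exact (h2 x x.2).trans (le_abs_self _)
  have hmean : ∀ x : K, (∫ z, Φ z ∂F) x = ∫ z, f z x ∂F := fun x => by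
    have := (ContinuousMap.evalCLM ℝ x).integral_comp_comm hΦi
    rw [ContinuousMap.evalCLM_apply] at this
    rw [← this]
    refine integral_congr_ae ?_
    filter_upwards [hΦf] with z hz
    exact hz x
  have hslln := strong_law_ae (fun i ω => Φ (ζ i ω)) (integrable_comp_hasLaw hlaw hΦi 0)
    (fun i j hij => (iIndepFun_comp hlaw hindep hΦm).indepFun hij)
    (identDistrib_comp hlaw hΦm)
  rw [integral_comp_hasLaw hlaw hΦi.aestronglyMeasurable] at hslln
  have hprob := tendstoInMeasure_iff_probFilter.1 (tendstoInMeasure_of_tendsto_ae (fun N => by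
    refine AEMeasurable.aestronglyMeasurable ?_
    exact AEMeasurable.fun_const_smul (Finset.aemeasurable_fun_sum _
      fun i _ => aemeasurable_comp_hasLaw hlaw hΦm i) _) hslln)
  rw [ContinuousMap.tendsto_iff_tendstoUniformly] at hprob
  constructor
  · rw [tendstoUniformlyOn_iff_tendstoUniformly_comp_coe]
    have hlim : (fun x => ∫ z, f z x ∂F) ∘ Subtype.val = ⇑(∫ z, Φ z ∂F) :=
      funext fun x => (hmean x).symm
    rw [hlim]
    intro u hu
    have h1 : ∀ᶠ y : ℕ × Ω in probFilter P, ∀ i, ∀ x : K, Φ (ζ i y.2) x = f (ζ i y.2) x :=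
      eventually_probFilter_of_ae fun _ => ae_of_hasLaw hlaw hΦf
    filter_upwards [hprob u hu, h1] with y hy hy' x
    convert hy x using 2
    rw [ContinuousMap.smul_apply, ContinuousMap.sum_apply, smul_eq_mul]
    simp only [hy']
  · rw [continuousOn_iff_continuous_domRestrict]
    convert (∫ z, Φ z ∂F).continuous using 1
    exact funext fun x => (hmean x).symm

/-- Chebyshev bound for the normalized sum of centered square-integrable variables. -/
lemma measure_normalized_sum_le [IsProbabilityMeasure P] (hlaw : ∀ i, HasLaw (ζ i) F P)
    (hindep : iIndepFun ζ P) {f : 𝓩 → ℝ} (hf : MemLp f 2 F) (h0 : ∫ z, f z ∂F = 0) {c : ℝ}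
    (hc : 0 < c) (N : ℕ) :
    P {ω | c < |√(N : ℝ) * ((N : ℝ)⁻¹ * ∑ i ∈ Finset.range N, f (ζ i ω))|} ≤
      ENNReal.ofReal (Var[f; F] / c ^ 2) := by
  have hL : ∀ i, MemLp (fun ω => f (ζ i ω)) 2 P := fun i =>
    MemLp.comp_of_map (by rwa [(hlaw i).map_eq]) (hlaw i).aemeasurable
  set S : Ω → ℝ := fun ω => √(N : ℝ) * ((N : ℝ)⁻¹ * ∑ i ∈ Finset.range N, f (ζ i ω)) with hS
  have hSL : MemLp S 2 P :=
    ((memLp_finsetSum _ fun i _ => hL i).const_mul _).const_mul _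
  have hmean : ∫ ω, S ω ∂P = 0 := by
    simp only [hS]
    rw [integral_const_mul, integral_const_mul, integral_finsetSum]
    · simp [integral_comp_hasLaw hlaw hf.aestronglyMeasurable, h0]
    · exact fun i _ => (hL i).integrable (by norm_num)
  have hvar : Var[S; P] ≤ Var[f; F] := by
    have h1 : Var[fun ω => ∑ i ∈ Finset.range N, f (ζ i ω); P] = N * Var[f; F] := by
      have := IndepFun.variance_sum (s := Finset.range N) (X := fun i ω => f (ζ i ω))
        (fun i _ => hL i) (fun i _ j _ hij =>
          (iIndepFun_comp hlaw hindep hf.aestronglyMeasurable.aemeasurable).indepFun hij)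
      have e : (∑ i ∈ Finset.range N, fun ω => f (ζ i ω)) =
        fun ω => ∑ i ∈ Finset.range N, f (ζ i ω) := by ext; simp
      rw [e] at this
      rw [this]
      have hv : ∀ i, Var[fun ω => f (ζ i ω); P] = Var[f; F] := fun i => by
        have := variance_map (X := f) (Y := ζ i) (μ := P)
          (by rw [(hlaw i).map_eq]; exact hf.aestronglyMeasurable.aemeasurable)
          (hlaw i).aemeasurable
        rw [(hlaw i).map_eq] at this
        exact this.symm
      simp [hv]
    simp only [hS]
    rw [variance_const_mul, variance_const_mul, h1, Real.sq_sqrt (Nat.cast_nonneg _)]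
    rcases Nat.eq_zero_or_pos N with h | h
    · simp [h, variance_nonneg]
    · have : (0 : ℝ) < N := Nat.cast_pos.2 h
      apply le_of_eq
      field_simp
  have := meas_ge_le_variance_div_sq hSL hc
  rw [hmean] at this
  simp only [sub_zero] at this
  refine (measure_mono fun ω (hω : c < |S ω|) => hω.le).trans (this.trans ?_)
  exact ENNReal.ofReal_le_ofReal (by gcongr)

/-- Normalized sums of centered square-integrable vectors are tight. -/
lemma tight_normalized_sum [IsProbabilityMeasure P] (hlaw : ∀ i, HasLaw (ζ i) F P)
    (hindep : iIndepFun ζ P) {r : Type*} [Fintype r] {f : 𝓩 → r → ℝ}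
    (hf : ∀ a, MemLp (fun z => f z a) 2 F) (h0 : ∀ a, ∫ z, f z a ∂F = 0) (ε : ENNReal)
    (hε : 0 < ε) :
    ∃ c, ∀ N : ℕ,
      P {ω | c < ‖√(N : ℝ) • ((N : ℝ)⁻¹ • ∑ i ∈ Finset.range N, f (ζ i ω))‖} ≤ ε := by
  have hlim : Tendsto (fun c : ℝ => ∑ a, ENNReal.ofReal (Var[fun z => f z a; F] / c ^ 2)) atTop
      (𝓝 (∑ _a : r, 0)) := by
    refine tendsto_finsetSum _ fun a _ => ?_
    have := ENNReal.tendsto_ofReal (tendsto_const_nhds (x := Var[fun z => f z a; F]).div_atTop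
      (tendsto_pow_atTop (α := ℝ) two_ne_zero))
    simpa using this
  rw [Finset.sum_const_zero] at hlim
  obtain ⟨c, hc, hc0⟩ :=
    ((ENNReal.tendsto_nhds_zero.1 hlim ε hε).and (eventually_gt_atTop 0)).exists
  refine ⟨c, fun N => le_trans ?_ hc⟩
  refine le_trans ((measure_mono ?_).trans (measure_iUnion_fintype_le P fun a : r =>
    {ω | c < |√(N : ℝ) * ((N : ℝ)⁻¹ * ∑ i ∈ Finset.range N, f (ζ i ω) a)|}))
    (Finset.sum_le_sum fun a _ => measure_normalized_sum_le hlaw hindep (hf a) (h0 a) hc0 N)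
  intro ω hω
  by_contra h
  simp only [Set.mem_iUnion, Set.mem_ofPred_eq, not_exists, not_lt] at h
  refine absurd hω (not_lt.2 ((pi_norm_le_iff_of_nonneg hc0.le).2 fun a => ?_))
  simpa [Finset.sum_apply] using h a

/-- A consequence of the central limit theorem: the squared norm of the normalized sum of
independent centered random vectors with identity covariance is asymptotically `χ²`. -/
theorem tendstoInDistribution_chiSquared [IsProbabilityMeasure F] [IsProbabilityMeasure P]
    (hlaw : ∀ i, HasLaw (ζ i) F P)
    (hindep : iIndepFun ζ P) {p : ℕ} {f : 𝓩 → Fin p → ℝ}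
    (hf : ∀ a, MemLp (fun z => f z a) 2 F) (h0 : ∀ a, ∫ z, f z a ∂F = 0)
    (h1 : ∀ a b, ∫ z, f z a * f z b ∂F = if a = b then 1 else 0) :
    TendstoInDistribution
      (fun (N : ℕ) ω => ∑ a, ((√(N : ℝ))⁻¹ * ∑ i ∈ Finset.range N, f (ζ i ω) a) ^ 2) atTop id
      (fun _ => P) (chiSquared p) := by
  have hfm : AEMeasurable f F :=
    aemeasurable_pi_iff.2 fun a => (hf a).aestronglyMeasurable.aemeasurable
  set S : ℕ → Ω → EuclideanSpace ℝ (Fin p) := fun N ω =>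
    WithLp.toLp 2 fun a => (√(N : ℝ))⁻¹ * ∑ i ∈ Finset.range N, f (ζ i ω) a with hS
  have hSm : ∀ N, AEMeasurable (S N) P := fun N => by
    refine (WithLp.measurable_toLp 2 _).comp_aemeasurable (aemeasurable_pi_iff.2 fun a => ?_)
    refine (Finset.aemeasurable_fun_sum _ fun i _ => ?_).const_mul _
    exact aemeasurable_comp_hasLaw hlaw (hf a).aestronglyMeasurable.aemeasurable i
  have hclt : TendstoInDistribution S atTop (WithLp.toLp 2 : (Fin p → ℝ) → EuclideanSpace ℝ (Fin p))
      (fun _ => P) (Measure.pi fun _ : Fin p => gaussianReal 0 1) := by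
    refine ⟨hSm, (WithLp.measurable_toLp 2 _).aemeasurable,
      ProbabilityMeasure.tendsto_iff_tendsto_charFun.2 fun t => ?_⟩
    -- Cramér–Wold: the characteristic function of the vector at `t` is that of the normalized sum
    -- of `X` at 1, and `X` is centered with variance |t|². The scalar central limit theorem
    -- therefore suffices.
    set X : 𝓩 → ℝ := fun z => ∑ a, t a * f z a with hX
    have hXL : MemLp X 2 F := memLp_finsetSum _ fun a _ => (hf a).const_mul (t a)
    have hXm := hXL.aestronglyMeasurable.aemeasurable
    have hX0 : ∫ z, X z ∂F = 0 := by
      simp only [hX]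
      rw [integral_finsetSum _ fun a _ => ((hf a).integrable (by norm_num)).const_mul _]
      simp [integral_const_mul, h0]
    have hXv : Var[X; F] = ∑ a, t a ^ 2 := by
      rw [variance_of_integral_eq_zero hXm hX0]
      have e : ∀ z, X z ^ 2 = ∑ a, ∑ b, (t a * t b) * (f z a * f z b) := fun z => by
        simp only [hX, sq, Finset.sum_mul_sum]
        exact Finset.sum_congr rfl fun a _ => Finset.sum_congr rfl fun b _ => by ring
      have hinteg : ∀ a b, Integrable (fun z => (t a * t b) * (f z a * f z b)) F := fun a b =>
        ((hf a).integrable_mul (hf b)).const_mul _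
      simp only [e]
      rw [integral_finsetSum _ fun a _ => integrable_finsetSum _ fun b _ => hinteg a b]
      refine Finset.sum_congr rfl fun a _ => ?_
      rw [integral_finsetSum _ fun b _ => hinteg a b]
      simp [integral_const_mul, h1, sq]
    have hXP : MemLp (fun ω => X (ζ 0 ω)) 2 P :=
      MemLp.comp_of_map (g := X) (by rwa [(hlaw 0).map_eq]) (hlaw 0).aemeasurable
    have hXPv : Var[fun ω => X (ζ 0 ω); P] = ∑ a, t a ^ 2 := by
      rw [← hXv]
      have := variance_map (X := X) (Y := ζ 0) (μ := P)
        (by rw [(hlaw 0).map_eq]; exact hXm) (hlaw 0).aemeasurable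
      rw [(hlaw 0).map_eq] at this
      exact this.symm
    have hone := (tendstoInDistribution_inv_sqrt_mul_sum_sub (X := fun i ω => X (ζ i ω))
      (Y := id) (P' := gaussianReal 0 (Var[fun ω => X (ζ 0 ω); P]).toNNReal) HasLaw.id hXP
      (iIndepFun_comp hlaw hindep hXm) (identDistrib_comp hlaw hXm)).tendsto
    have h2 := ProbabilityMeasure.tendsto_iff_tendsto_charFun.1 hone 1
    simp only [ProbabilityMeasure.coe_mk, Measure.map_id, charFun_gaussianReal, hXPv,
      integral_comp_hasLaw hlaw hXL.aestronglyMeasurable, hX0, mul_zero, sub_zero] at h2 ⊢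
    rw [charFun_pi]
    convert h2 using 1
    · ext N
      rw [charFun_apply, charFun_apply_real, integral_map (hSm N) (by fun_prop),
        integral_map _ (by fun_prop)]
      · refine integral_congr_ae (.of_forall fun ω => ?_)
        simp only
        congr 2
        norm_cast
        rw [one_mul]
        simp only [hS, hX, PiLp.inner_apply]
        simp only [RCLike.inner_apply, conj_trivial]
        rw [Finset.sum_comm, Finset.mul_sum]
        refine Finset.sum_congr rfl fun a _ => ?_
        rw [← Finset.mul_sum]
        ring
      · exact (Finset.aemeasurable_fun_sum _ fun i _ =>
          aemeasurable_comp_hasLaw hlaw hXm i).const_mul _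
    · congr 1
      simp only [charFun_gaussianReal]
      rw [← Complex.exp_sum]
      congr 1
      have hnn : 0 ≤ ∑ a, t a ^ 2 := Finset.sum_nonneg fun a _ => sq_nonneg _
      simp [Real.coe_toNNReal _ hnn, Finset.sum_div, Finset.sum_neg_distrib]
  have hcont : Continuous fun x : EuclideanSpace ℝ (Fin p) => ∑ a, x a ^ 2 := by fun_prop
  have hsq := hclt.continuous_comp hcont
  refine ⟨hsq.forall_aemeasurable, aemeasurable_id, ?_⟩
  have hm : (Measure.pi fun _ : Fin p => gaussianReal 0 1).map
      ((fun x : EuclideanSpace ℝ (Fin p) => ∑ a, x a ^ 2) ∘ WithLp.toLp 2) =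
      (chiSquared p).map id := by
    rw [Measure.map_id]; rfl
  exact hsq.tendsto.mono_right (le_of_eq (congrArg 𝓝 (Subtype.ext hm)))

end Sample

/-! ### Measurability, continuity and conditional mean of the score. -/

section Score

variable {n q s : ℕ}

namespace Spec

variable (S : Spec n q s)

/-- The coefficient of the residual at time `t` in the component `a` of the score. -/
noncomputable def weight (x : Fin n → Fin q → ℝ) (β : Fin q → ℝ) (a : Fin s × Fin q)
    (t : Fin n) : ℝ :=
  ∑ t', partialDeriv (fun b => S.meanVec x b t') a.2 β * (√(S.φ * S.v (x t' ⬝ᵥ β)))⁻¹ *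
    S.M a.1 t' t * (√(S.φ * S.v (x t ⬝ᵥ β)))⁻¹

lemma score_eq_sum (z : Datum n q) (β : Fin q → ℝ) (a : Fin s × Fin q) :
    S.score z β a = ∑ t, S.weight z.2 β a t * (z.1 t - S.h (z.2 t ⬝ᵥ β)) := by
  simp only [score, Matrix.mulVec, dotProduct, invSqrtVar, Matrix.mul_diagonal, weight,
    Pi.sub_apply, meanVec]
  refine Finset.sum_congr rfl fun t _ => ?_
  congr 1
  rw [Matrix.mul_apply, Finset.sum_mul]
  refine Finset.sum_congr rfl fun t' _ => ?_
  rw [Matrix.mul_diagonal]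
  rfl

/-- A version of `h` that is Borel measurable on the whole line. -/
noncomputable def linkVersion : ℝ → ℝ := S.dom.indicator S.h

/-- A version of `v` that is Borel measurable on the whole line. -/
noncomputable def varVersion : ℝ → ℝ := S.dom.indicator S.v

/-- A jointly measurable version of `weight`. -/
noncomputable def weightVersion (x : Fin n → Fin q → ℝ) (β : Fin q → ℝ) (a : Fin s × Fin q)
    (t : Fin n) : ℝ :=
  ∑ t', deriv S.h (x t' ⬝ᵥ β) * x t' a.2 * (√(S.φ * S.varVersion (x t' ⬝ᵥ β)))⁻¹ *
    S.M a.1 t' t * (√(S.φ * S.varVersion (x t ⬝ᵥ β)))⁻¹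

/-- A jointly measurable version of `score`. -/
noncomputable def scoreVersion (z : Datum n q) (β : Fin q → ℝ) (a : Fin s × Fin q) : ℝ :=
  ∑ t, S.weightVersion z.2 β a t * (z.1 t - S.linkVersion (z.2 t ⬝ᵥ β))

end Spec

variable [NeZero s] {S : Spec n q s} {F : Measure (Datum n q)} {B : Set (Fin q → ℝ)}
  {β₀ : Fin q → ℝ}

namespace Regular

lemma hasDerivAt_link (hreg : Regular S F B β₀) {η : ℝ} (hη : η ∈ S.dom) :
    HasDerivAt S.h (deriv S.h η) η :=
  ((hreg.link_contDiffOn.differentiableOn one_ne_zero).differentiableAt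
    (hreg.isOpen_dom.mem_nhds hη)).hasDerivAt

lemma hasFDerivAt_linPred (y β : Fin q → ℝ) :
    HasFDerivAt (fun b : Fin q → ℝ => y ⬝ᵥ b)
      (LinearMap.toContinuousLinearMap (dotProductBilin ℝ ℝ y)) β :=
  (LinearMap.toContinuousLinearMap (dotProductBilin ℝ ℝ y)).hasFDerivAt

lemma partialDeriv_mean (hreg : Regular S F B β₀) {x : Fin n → Fin q → ℝ} {β : Fin q → ℝ}
    {t : Fin n} (ht : x t ⬝ᵥ β ∈ S.dom) (k : Fin q) :
    partialDeriv (fun b => S.meanVec x b t) k β = deriv S.h (x t ⬝ᵥ β) * x t k := by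
  have h := (hreg.hasDerivAt_link ht).comp_hasFDerivAt β (hasFDerivAt_linPred (x t) β)
  rw [partialDeriv]
  change fderiv ℝ (S.h ∘ fun b => x t ⬝ᵥ b) β _ = _
  rw [h.fderiv]
  simp

lemma weight_eq (hreg : Regular S F B β₀) {x : Fin n → Fin q → ℝ} {β : Fin q → ℝ}
    (hx : ∀ t, x t ⬝ᵥ β ∈ S.dom) (a : Fin s × Fin q) (t : Fin n) :
    S.weight x β a t = S.weightVersion x β a t := by
  simp only [Spec.weight, Spec.weightVersion, hreg.partialDeriv_mean (hx _), Spec.varVersion,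
    Set.indicator_of_mem (hx _)]

lemma score_eq (hreg : Regular S F B β₀) {z : Datum n q} {β : Fin q → ℝ}
    (hx : ∀ t, z.2 t ⬝ᵥ β ∈ S.dom) (a : Fin s × Fin q) :
    S.score z β a = S.scoreVersion z β a := by
  simp only [Spec.score_eq_sum, Spec.scoreVersion, hreg.weight_eq hx, Spec.linkVersion,
    Set.indicator_of_mem (hx _)]

lemma measurable_linkVersion (hreg : Regular S F B β₀) : Measurable S.linkVersion := by
  classical
  rw [Spec.linkVersion, ← Set.piecewise_eq_indicator]
  exact hreg.link_contDiffOn.continuousOn.measurable_piecewise continuousOn_const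
    hreg.isOpen_dom.measurableSet

lemma measurable_varVersion (hreg : Regular S F B β₀) : Measurable S.varVersion := by
  classical
  rw [Spec.varVersion, ← Set.piecewise_eq_indicator]
  exact hreg.var_continuousOn.measurable_piecewise continuousOn_const
    hreg.isOpen_dom.measurableSet

lemma measurable_linPred (t : Fin n) :
    Measurable fun w : (Fin n → Fin q → ℝ) × (Fin q → ℝ) => w.1 t ⬝ᵥ w.2 := by
  simp only [dotProduct]
  fun_prop

lemma measurable_weightVersion (hreg : Regular S F B β₀) (a : Fin s × Fin q) (t : Fin n) :
    Measurable fun w : (Fin n → Fin q → ℝ) × (Fin q → ℝ) => S.weightVersion w.1 w.2 a t := by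
  have hv := hreg.measurable_varVersion
  have hd : Measurable (deriv S.h) := measurable_deriv S.h
  have hl := fun t : Fin n => measurable_linPred (q := q) t
  have hi : ∀ t : Fin n, Measurable fun w : (Fin n → Fin q → ℝ) × (Fin q → ℝ) =>
      (√(S.φ * S.varVersion (w.1 t ⬝ᵥ w.2)))⁻¹ := fun t =>
    (((hv.comp (hl t)).const_mul _).sqrt).inv
  refine Finset.measurable_fun_sum _ fun t' _ => ?_
  exact ((((hd.comp (hl t')).mul (by fun_prop)).mul (hi t')).mul_const _).mul (hi t)

/-- The functions `h` and `v` are uncontrolled outside `S.dom`, hence the versions that vanish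
there. Measurability must be joint, because the score is later evaluated at random parameters. -/
lemma measurable_scoreVersion (hreg : Regular S F B β₀) (a : Fin s × Fin q) :
    Measurable fun w : Datum n q × (Fin q → ℝ) => S.scoreVersion w.1 w.2 a := by
  have hp : Measurable fun w : Datum n q × (Fin q → ℝ) => (w.1.2, w.2) := by fun_prop
  refine Finset.measurable_fun_sum _ fun t _ => ?_
  refine ((hreg.measurable_weightVersion a t).comp hp).mul (Measurable.sub (by fun_prop) ?_)
  exact hreg.measurable_linkVersion.comp ((measurable_linPred t).comp hp)

lemma measurable_scoreVersion_left (hreg : Regular S F B β₀) (β : Fin q → ℝ)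
    (a : Fin s × Fin q) : Measurable fun z => S.scoreVersion z β a :=
  Measurable.comp (g := fun w : Datum n q × (Fin q → ℝ) => S.scoreVersion w.1 w.2 a)
    (f := fun z : Datum n q => (z, β)) (hreg.measurable_scoreVersion a)
    (measurable_id.prodMk measurable_const)

lemma score_ae_eq (hreg : Regular S F B β₀) {β : Fin q → ℝ} (hβ : β ∈ B)
    (a : Fin s × Fin q) : (fun z => S.score z β a) =ᵐ[F] fun z => S.scoreVersion z β a :=
  hreg.linPred_mem.mono fun _ hz => hreg.score_eq (hz β hβ) a

lemma aemeasurable_score (hreg : Regular S F B β₀) {β : Fin q → ℝ} (hβ : β ∈ B)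
    (a : Fin s × Fin q) : AEMeasurable (fun z => S.score z β a) F :=
  (hreg.measurable_scoreVersion_left β a).aemeasurable.congr (hreg.score_ae_eq hβ a).symm

lemma continuousOn_weight (hreg : Regular S F B β₀) {x : Fin n → Fin q → ℝ}
    (hx : ∀ β ∈ B, ∀ t, x t ⬝ᵥ β ∈ S.dom) (a : Fin s × Fin q) (t : Fin n) :
    ContinuousOn (fun β => S.weight x β a t) B := by
  have hl : ∀ t, ContinuousOn (fun β => x t ⬝ᵥ β) B := fun t =>
    (continuous_const.dotProduct continuous_id).continuousOn
  have hd : ∀ t, ContinuousOn (fun β => deriv S.h (x t ⬝ᵥ β)) B := fun t =>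
    (hreg.link_contDiffOn.continuousOn_deriv_of_isOpen hreg.isOpen_dom le_rfl).comp (hl t)
      fun β hβ => hx β hβ t
  have hi : ∀ t, ContinuousOn (fun β => (√(S.φ * S.v (x t ⬝ᵥ β)))⁻¹) B := fun t => by
    refine ContinuousOn.inv₀ ((hreg.var_continuousOn.comp (hl t)
      fun β hβ => hx β hβ t).const_mul _ |>.sqrt) fun β hβ => ?_
    exact (Real.sqrt_pos.2 (mul_pos hreg.dispersion_pos (hreg.var_pos _ (hx β hβ t)))).ne'
  have : ContinuousOn (fun β => ∑ t', deriv S.h (x t' ⬝ᵥ β) * x t' a.2 *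
      (√(S.φ * S.v (x t' ⬝ᵥ β)))⁻¹ * S.M a.1 t' t * (√(S.φ * S.v (x t ⬝ᵥ β)))⁻¹) B :=
    continuousOn_finsetSum _ fun t' _ =>
      ((((hd t').mul continuousOn_const).mul (hi t')).mul continuousOn_const).mul (hi t)
  refine this.congr fun β hβ => ?_
  simp only [Spec.weight, hreg.partialDeriv_mean (hx β hβ _)]

/-- The differentiability hypothesis on the score concerns the interior only. Continuity up to the
boundary of the compact `B`, needed for the uniform law, is read off from the formula. -/
lemma continuousOn_score (hreg : Regular S F B β₀) (a : Fin s × Fin q) :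
    ∀ᵐ z ∂F, ContinuousOn (fun β => S.score z β a) B := by
  filter_upwards [hreg.linPred_mem] with z hz
  simp only [Spec.score_eq_sum]
  refine continuousOn_finsetSum _ fun t _ => (hreg.continuousOn_weight hz a t).mul ?_
  exact continuousOn_const.sub (hreg.link_contDiffOn.continuousOn.comp
    (continuous_const.dotProduct continuous_id).continuousOn fun β hβ => hz β hβ t)

lemma integrable_score (hreg : Regular S F B β₀) {β : Fin q → ℝ} (hβ : β ∈ B)
    (a : Fin s × Fin q) : Integrable (fun z => S.score z β a) F := by
  obtain ⟨H, hH, hb⟩ := hreg.score_envelope a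
  exact hH.mono' (hreg.aemeasurable_score hβ a).aestronglyMeasurable
    (hb.mono fun z hz => hz β hβ)

lemma memLp_score (hreg : Regular S F B β₀) {β : Fin q → ℝ} (hβ : β ∈ B)
    (a : Fin s × Fin q) : MemLp (fun z => S.score z β a) 2 F := by
  rw [memLp_two_iff_integrable_sq (hreg.aemeasurable_score hβ a).aestronglyMeasurable]
  obtain ⟨H, hH, hb⟩ := hreg.prod_envelope a a
  refine hH.mono' ((hreg.aemeasurable_score hβ a).pow_const 2).aestronglyMeasurable
    (hb.mono fun z hz => ?_)
  rw [sq]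
  exact hz β hβ

variable [IsProbabilityMeasure F]

/-- The conditional mean of the score given the covariates. -/
theorem condExp_score (hreg : Regular S F B β₀) {β : Fin q → ℝ} (hβ : β ∈ B)
    (a : Fin s × Fin q) :
    F[fun z => S.score z β a | covariateSigma n q] =ᵐ[F]
      fun z => ∑ t, S.weight z.2 β a t * (S.h (z.2 t ⬝ᵥ β₀) - S.h (z.2 t ⬝ᵥ β)) := by
  have hm : covariateSigma n q ≤ (inferInstance : MeasurableSpace (Datum n q)) :=
    measurable_snd.comap_le
  set w : Fin n → Datum n q → ℝ := fun t z => S.weightVersion z.2 β a t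
  set e : Fin n → Datum n q → ℝ := fun t z => S.linkVersion (z.2 t ⬝ᵥ β)
  have hpair : Measurable fun x : Fin n → Fin q → ℝ => (x, β) :=
    measurable_id.prodMk measurable_const
  have hsnd : Measurable[covariateSigma n q] (Prod.snd : Datum n q → Fin n → Fin q → ℝ) :=
    comap_measurable _
  have hw : ∀ t, Measurable[covariateSigma n q] (w t) := fun t =>
    ((hreg.measurable_weightVersion a t).comp hpair).comp hsnd
  have he : ∀ t, Measurable[covariateSigma n q] (e t) := fun t =>
    (hreg.measurable_linkVersion.comp ((measurable_linPred t).comp hpair)).comp hsnd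
  -- The score is integrable, but its summands weight × response need not be. On `A m`, an event of
  -- the covariates, the coefficients are bounded and can be pulled out of the conditional
  -- expectation. These events exhaust the space.
  set A : ℕ → Set (Datum n q) := fun m => {z | ∀ t, |w t z| ≤ m ∧ |e t z| ≤ m} with hA
  have hAm : ∀ m, MeasurableSet[covariateSigma n q] (A m) := fun m => by
    have : A m = ⋂ t, {z | |w t z| ≤ m} ∩ {z | |e t z| ≤ m} := by ext; simp [hA]
    rw [this]
    refine MeasurableSet.iInter fun t => MeasurableSet.inter ?_ ?_
    · exact measurableSet_le (measurable_norm.comp (hw t)) measurable_const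
    · exact measurableSet_le (measurable_norm.comp (he t)) measurable_const
  have key : ∀ m : ℕ, ∀ᵐ z ∂F, z ∈ A m →
      (F[fun z => S.score z β a | covariateSigma n q]) z =
        ∑ t, w t z * (S.h (z.2 t ⬝ᵥ β₀) - e t z) := by
    intro m
    set κ : Fin n → Datum n q → ℝ := fun t => (A m).indicator (w t)
    set τ : Fin n → Datum n q → ℝ := fun t => (A m).indicator (w t * e t)
    have hκ : ∀ t, StronglyMeasurable[covariateSigma n q] (κ t) := fun t =>
      ((hw t).indicator (hAm m)).stronglyMeasurable
    have hτ : ∀ t, StronglyMeasurable[covariateSigma n q] (τ t) := fun t =>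
      (((hw t).mul (he t)).indicator (hAm m)).stronglyMeasurable
    have hκb : ∀ t z, ‖κ t z‖ ≤ m := fun t z => by
      by_cases hz : z ∈ A m
      · simpa [κ, hz] using (hz t).1
      · simp [κ, hz]
    have hτb : ∀ t z, ‖τ t z‖ ≤ (m : ℝ) * m := fun t z => by
      by_cases hz : z ∈ A m
      · simp only [τ, Set.indicator_of_mem hz, Pi.mul_apply, norm_mul]
        exact mul_le_mul (hz t).1 (hz t).2 (norm_nonneg _) (Nat.cast_nonneg _)
      · simp only [τ, Set.indicator_of_notMem hz, norm_zero]
        positivity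
    have hτi : ∀ t, Integrable (τ t) F := fun t =>
      Integrable.of_bound ((hτ t).mono hm).aestronglyMeasurable _ (.of_forall (hτb t))
    have hκY : ∀ t, Integrable (κ t * fun z => z.1 t) F := fun t =>
      (hreg.response_integrable t).bdd_mul ((hκ t).mono hm).aestronglyMeasurable
        (.of_forall (hκb t))
    have h1 : (A m).indicator (fun z => S.score z β a) =ᵐ[F]
        ∑ t, ((κ t * fun z => z.1 t) - τ t) := by
      filter_upwards [hreg.linPred_mem] with z hz
      by_cases hzA : z ∈ A m
      · simp only [Set.indicator_of_mem hzA, Finset.sum_apply, Pi.sub_apply, Pi.mul_apply, κ, τ,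
          hreg.score_eq (hz β hβ), Spec.scoreVersion]
        exact Finset.sum_congr rfl fun t _ => by ring
      · simp [κ, τ, hzA]
    have h2 := condExp_indicator (hreg.integrable_score hβ a) (hAm m)
    have h3 := condExp_congr_ae (m := covariateSigma n q) h1
    have h4 := condExp_finsetSum (m := covariateSigma n q) (s := Finset.univ)
      fun t (_ : t ∈ Finset.univ) => (hκY t).sub (hτi t)
    have h5 : ∀ t, F[(κ t * fun z => z.1 t) - τ t | covariateSigma n q] =ᵐ[F]
        fun z => κ t z * S.h (z.2 t ⬝ᵥ β₀) - τ t z := fun t => by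
      have h6 := condExp_sub (hκY t) (hτi t) (covariateSigma n q)
      have h7 := condExp_mul_of_stronglyMeasurable_left (hκ t) (hκY t) (hreg.response_integrable t)
      have h8 := condExp_of_stronglyMeasurable hm (hτ t) (hτi t)
      filter_upwards [h6, h7, hreg.cond_mean t] with z h6 h7 h9
      rw [h6, Pi.sub_apply, h7, h8, Pi.mul_apply, h9]
    filter_upwards [h2, h3, h4, ae_all_iff.2 h5] with z h2 h3 h4 h5 hz
    rw [Set.indicator_of_mem hz] at h2
    rw [← h2, h3, h4, Finset.sum_apply]
    refine Finset.sum_congr rfl fun t _ => ?_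
    rw [h5 t]
    simp only [κ, τ, Set.indicator_of_mem hz, Pi.mul_apply]
    ring
  filter_upwards [ae_all_iff.2 key, hreg.linPred_mem] with z hz hzd
  obtain ⟨m, hmz⟩ : ∃ m : ℕ, z ∈ A m := by
    obtain ⟨m, hm⟩ := exists_nat_ge (∑ t, (|w t z| + |e t z|))
    refine ⟨m, fun t => ?_⟩
    have := Finset.single_le_sum (f := fun t => |w t z| + |e t z|) (fun _ _ => by positivity)
      (Finset.mem_univ t)
    constructor <;> linarith [abs_nonneg (w t z), abs_nonneg (e t z)]
  rw [hz m hmz]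
  refine Finset.sum_congr rfl fun t _ => ?_
  simp only [w, e, ← hreg.weight_eq (hzd β hβ), Spec.linkVersion,
    Set.indicator_of_mem (hzd β hβ t)]

lemma integral_score (hreg : Regular S F B β₀) {β : Fin q → ℝ} (hβ : β ∈ B)
    (a : Fin s × Fin q) :
    ∫ z, S.score z β a ∂F =
      ∫ z, ∑ t, S.weight z.2 β a t * (S.h (z.2 t ⬝ᵥ β₀) - S.h (z.2 t ⬝ᵥ β)) ∂F := by
  rw [← integral_condExp (m := covariateSigma n q) measurable_snd.comap_le]
  exact integral_congr_ae (hreg.condExp_score hβ a)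

lemma integral_score_true (hreg : Regular S F B β₀) (a : Fin s × Fin q) :
    ∫ z, S.score z β₀ a ∂F = 0 := by
  rw [hreg.integral_score (interior_subset hreg.true_mem)]
  simp

end Regular

end Score

/-! ### The expected derivative of the score and positive definiteness of J. -/

section ScoreDerivative

variable {n q s : ℕ}

lemma exists_steps {U : Set (Fin q → ℝ)} (hU : IsOpen U) {β : Fin q → ℝ} (hβ : β ∈ U)
    (v : Fin q → ℝ) : ∃ τ : ℕ → ℝ, (∀ m, 0 < τ m) ∧ Tendsto τ atTop (𝓝 0) ∧
      ∀ m, β + τ m • v ∈ U := by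
  have h0 : Tendsto (fun m : ℕ => 1 / ((m : ℝ) + 1)) atTop (𝓝 0) :=
    tendsto_one_div_add_atTop_nhds_zero_nat
  have h1 : Tendsto (fun m : ℕ => β + (1 / ((m : ℝ) + 1)) • v) atTop (𝓝 (β + (0 : ℝ) • v)) :=
    (h0.smul_const v).const_add β
  rw [zero_smul, add_zero] at h1
  obtain ⟨M, hM⟩ := eventually_atTop.1 (h1.eventually (hU.mem_nhds hβ))
  refine ⟨fun m => 1 / (((m + M : ℕ) : ℝ) + 1), fun m => by positivity,
    (tendsto_add_atTop_iff_nat M).2 h0, fun m => hM _ (Nat.le_add_left _ _)⟩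

lemma tendsto_differenceQuotient {f : (Fin q → ℝ) → ℝ} {β : Fin q → ℝ}
    (hf : DifferentiableAt ℝ f β) (v : Fin q → ℝ) {τ : ℕ → ℝ} (hτ : ∀ m, 0 < τ m)
    (hτ0 : Tendsto τ atTop (𝓝 0)) :
    Tendsto (fun m => (τ m)⁻¹ * (f (β + τ m • v) - f β)) atTop (𝓝 (fderiv ℝ f β v)) :=
  (hf.hasFDerivAt.hasLineDerivAt v).tendsto_slope_zero.comp
    (tendsto_nhdsWithin_iff.2 ⟨hτ0, .of_forall fun m => (hτ m).ne'⟩)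

lemma aemeasurable_fderiv_apply {𝓩 : Type*} [MeasurableSpace 𝓩] {F : Measure 𝓩}
    {f : 𝓩 → (Fin q → ℝ) → ℝ} {U : Set (Fin q → ℝ)} (hU : IsOpen U)
    (hf : ∀ β ∈ U, AEMeasurable (fun z => f z β) F) {β : Fin q → ℝ} (hβ : β ∈ U)
    (hd : ∀ᵐ z ∂F, DifferentiableAt ℝ (f z) β) (v : Fin q → ℝ) :
    AEMeasurable (fun z => fderiv ℝ (f z) β v) F := by
  obtain ⟨τ, hτ, hτ0, hτU⟩ := exists_steps hU hβ v
  refine aemeasurable_of_tendsto_metrizable_ae atTop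
    (f := fun m z => (τ m)⁻¹ * (f z (β + τ m • v) - f z β))
    (fun m => ((hf _ (hτU m)).sub (hf _ hβ)).const_mul _) ?_
  filter_upwards [hd] with z hz
  exact tendsto_differenceQuotient hz v hτ hτ0

lemma abs_partialDeriv_le (f : (Fin q → ℝ) → ℝ) (k : Fin q) (β : Fin q → ℝ) :
    |partialDeriv f k β| ≤ ‖iteratedFDeriv ℝ 1 f β‖ := by
  rw [norm_iteratedFDeriv_one, partialDeriv, ← Real.norm_eq_abs]
  refine (ContinuousLinearMap.le_opNorm _ _).trans ?_
  rw [Pi.norm_single, norm_one, mul_one]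

variable [NeZero s] {S : Spec n q s} {F : Measure (Datum n q)} {B : Set (Fin q → ℝ)}
  {β₀ : Fin q → ℝ}

namespace Regular

lemma contDiffOn_score_apply (hreg : Regular S F B β₀) :
    ∀ᵐ z ∂F, ∀ a, ContDiffOn ℝ 2 (fun β => S.score z β a) (interior B) := by
  filter_upwards [hreg.score_contDiffOn] with z hz
  exact contDiffOn_pi.1 hz

lemma differentiableAt_score (hreg : Regular S F B β₀) :
    ∀ᵐ z ∂F, ∀ a, ∀ β ∈ interior B, DifferentiableAt ℝ (fun b => S.score z b a) β := by
  filter_upwards [hreg.contDiffOn_score_apply] with z hz a β hβ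
  exact ((hz a).differentiableOn two_ne_zero).differentiableAt (isOpen_interior.mem_nhds hβ)

lemma continuousOn_partialDeriv_score (hreg : Regular S F B β₀) (a : Fin s × Fin q) (k : Fin q) :
    ∀ᵐ z ∂F, ContinuousOn (partialDeriv (fun b => S.score z b a) k) (interior B) := by
  filter_upwards [hreg.contDiffOn_score_apply] with z hz
  exact ((hz a).continuousOn_fderiv_of_isOpen isOpen_interior one_le_two).clm_apply
    continuousOn_const

lemma aemeasurable_fderiv_score (hreg : Regular S F B β₀) (a : Fin s × Fin q) {β : Fin q → ℝ}
    (hβ : β ∈ interior B) (v : Fin q → ℝ) :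
    AEMeasurable (fun z => fderiv ℝ (fun b => S.score z b a) β v) F :=
  aemeasurable_fderiv_apply isOpen_interior
    (fun _ h => hreg.aemeasurable_score (interior_subset h) a) hβ
    (hreg.differentiableAt_score.mono fun _ hz => hz a β hβ) v

lemma aemeasurable_fderiv_prod (hreg : Regular S F B β₀) (a a' : Fin s × Fin q) {β : Fin q → ℝ}
    (hβ : β ∈ interior B) (v : Fin q → ℝ) :
    AEMeasurable (fun z => fderiv ℝ (fun b => S.score z b a * S.score z b a') β v) F :=
  aemeasurable_fderiv_apply isOpen_interior
    (fun _ h => (hreg.aemeasurable_score (interior_subset h) a).mul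
      (hreg.aemeasurable_score (interior_subset h) a')) hβ
    (hreg.differentiableAt_score.mono fun _ hz => (hz a β hβ).mul (hz a' β hβ)) v

variable [IsProbabilityMeasure F]

/-- The expected derivative of the score at the true parameter, by conditioning on the
covariates. -/
theorem integral_fderiv_score (hreg : Regular S F B β₀) (a : Fin s × Fin q) (c : Fin q → ℝ) :
    Integrable (fun z : Datum n q => ∑ t, S.weight z.2 β₀ a t *
      (deriv S.h (z.2 t ⬝ᵥ β₀) * (z.2 t ⬝ᵥ c))) F ∧
    ∫ z, fderiv ℝ (fun b => S.score z b a) β₀ c ∂F =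
      -∫ z : Datum n q, ∑ t, S.weight z.2 β₀ a t *
        (deriv S.h (z.2 t ⬝ᵥ β₀) * (z.2 t ⬝ᵥ c)) ∂F := by
  obtain ⟨ρ, hρ, hball⟩ := Metric.isOpen_iff.1 isOpen_interior β₀ hreg.true_mem
  have hβ₀ : β₀ ∈ B := interior_subset hreg.true_mem
  obtain ⟨τ, hτ, hτ0, hτU⟩ := exists_steps Metric.isOpen_ball (Metric.mem_ball_self hρ) c
  have hτB : ∀ m, β₀ + τ m • c ∈ B := fun m => interior_subset (hball (hτU m))
  obtain ⟨H, hH, hHb⟩ := hreg.score_deriv_envelope a 1 (by simp)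
  set fs : ℕ → Datum n q → ℝ := fun m z =>
    (τ m)⁻¹ * (S.score z (β₀ + τ m • c) a - S.score z β₀ a) with hfs
  -- This is the conditional mean of the difference quotient `fs m`: the score at `β₀` has
  -- conditional mean zero, so only increments of `h` are left. The weights, for which only
  -- continuity is available, are never differentiated.
  set gs : ℕ → Datum n q → ℝ := fun m z => ∑ t, S.weight z.2 (β₀ + τ m • c) a t *
    -((τ m)⁻¹ * (S.h (z.2 t ⬝ᵥ (β₀ + τ m • c)) - S.h (z.2 t ⬝ᵥ β₀))) with hgs
  have hfsi : ∀ m, Integrable (fs m) F := fun m =>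
    ((hreg.integrable_score (hτB m) a).sub (hreg.integrable_score hβ₀ a)).const_mul _
  have hbi : Integrable (fun z => H z * ‖c‖) F := hH.mul_const _
  have hfsb : ∀ m, ∀ᵐ z ∂F, ‖fs m z‖ ≤ H z * ‖c‖ := fun m => by
    filter_upwards [hHb, hreg.differentiableAt_score] with z h1 h2
    have h3 := Convex.norm_image_sub_le_of_norm_fderiv_le (𝕜 := ℝ) (C := H z)
      (fun x hx => h2 a x (hball hx)) (fun x hx => by
        have := h1 x (hball hx)
        rwa [abs_norm, norm_iteratedFDeriv_one] at this) (convex_ball β₀ ρ)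
      (Metric.mem_ball_self hρ) (hτU m)
    rw [hfs, norm_mul, norm_inv, Real.norm_of_nonneg (hτ m).le, inv_mul_le_iff₀ (hτ m)]
    refine h3.trans (le_of_eq ?_)
    rw [add_sub_cancel_left, norm_smul, Real.norm_of_nonneg (hτ m).le]
    ring
  have hfsl : ∀ᵐ z ∂F, Tendsto (fun m => fs m z) atTop
      (𝓝 (fderiv ℝ (fun b => S.score z b a) β₀ c)) := by
    filter_upwards [hreg.differentiableAt_score] with z hz
    exact tendsto_differenceQuotient (hz a β₀ hreg.true_mem) c hτ hτ0
  have hcond : ∀ m, F[fs m | covariateSigma n q] =ᵐ[F] gs m := fun m => by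
    have h1 := condExp_smul (τ m)⁻¹ ((fun z => S.score z (β₀ + τ m • c) a) -
      fun z => S.score z β₀ a) (covariateSigma n q) (μ := F)
    have h2 := condExp_sub (hreg.integrable_score (hτB m) a) (hreg.integrable_score hβ₀ a)
      (covariateSigma n q)
    filter_upwards [h1, h2, hreg.condExp_score (hτB m) a, hreg.condExp_score hβ₀ a]
      with z h1 h2 h3 h4
    refine h1.trans ?_
    rw [Pi.smul_apply, h2, Pi.sub_apply, h3, h4]
    simp only [sub_self, mul_zero, Finset.sum_const_zero, sub_zero, smul_eq_mul, hgs,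
      Finset.mul_sum]
    exact Finset.sum_congr rfl fun t _ => by ring
  have hgsl : ∀ᵐ z ∂F, Tendsto (fun m => gs m z) atTop (𝓝 (∑ t, S.weight z.2 β₀ a t *
      -(deriv S.h (z.2 t ⬝ᵥ β₀) * (z.2 t ⬝ᵥ c)))) := by
    filter_upwards [hreg.linPred_mem] with z hz
    refine tendsto_finsetSum _ fun t _ => Tendsto.mul ?_ (Tendsto.neg ?_)
    · have h1 : Tendsto (fun m => β₀ + τ m • c) atTop (𝓝 (β₀ + (0 : ℝ) • c)) :=
        (hτ0.smul_const c).const_add β₀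
      rw [zero_smul, add_zero] at h1
      exact ((hreg.continuousOn_weight hz a t) β₀ hβ₀).tendsto.comp
        (tendsto_nhdsWithin_iff.2 ⟨h1, .of_forall hτB⟩)
    · have h1 := (hreg.hasDerivAt_link (hz β₀ hβ₀ t)).comp_hasFDerivAt β₀
        (hasFDerivAt_linPred (z.2 t) β₀)
      have h2 := tendsto_differenceQuotient h1.differentiableAt c hτ hτ0
      rw [h1.fderiv] at h2
      simpa using h2
  -- Conditioning the bound on `fs m` gives one integrable bound for all `gs m`. Both sequences thus
  -- pass to the limit by dominated convergence, with equal integrals.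
  have hgsb : ∀ m, ∀ᵐ z ∂F, ‖gs m z‖ ≤
      (F[fun z => H z * ‖c‖ | covariateSigma n q]) z := fun m => by
    have h1 := condExp_mono (m := covariateSigma n q) (hfsi m) hbi
      ((hfsb m).mono fun z hz => (le_abs_self _).trans hz)
    have h2 := condExp_mono (m := covariateSigma n q) (hfsi m).neg hbi
      ((hfsb m).mono fun z hz => (neg_le_abs _).trans hz)
    filter_upwards [h1, h2, condExp_neg (fs m) (covariateSigma n q), hcond m] with z h1 h2 h3 h4
    rw [h3, Pi.neg_apply] at h2
    rw [← h4, Real.norm_eq_abs, abs_le']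
    exact ⟨h1, h2⟩
  have hgsm : ∀ m, AEStronglyMeasurable (gs m) F := fun m =>
    integrable_condExp.aestronglyMeasurable.congr (hcond m)
  have hlim1 := tendsto_integral_of_dominated_convergence _ (fun m => (hfsi m).1) hbi hfsb hfsl
  have hlim2 := tendsto_integral_of_dominated_convergence _ hgsm integrable_condExp hgsb hgsl
  have heq : ∀ m, ∫ z, fs m z ∂F = ∫ z, gs m z ∂F := fun m => by
    rw [← integral_condExp (m := covariateSigma n q) measurable_snd.comap_le]
    exact integral_congr_ae (hcond m)
  simp only [heq] at hlim1
  have h := tendsto_nhds_unique hlim1 hlim2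
  have hinteg : Integrable (fun z : Datum n q => ∑ t, S.weight z.2 β₀ a t *
      -(deriv S.h (z.2 t ⬝ᵥ β₀) * (z.2 t ⬝ᵥ c))) F := by
    refine Integrable.mono' (integrable_condExp (m := covariateSigma n q)
      (f := fun z => H z * ‖c‖)) (aestronglyMeasurable_of_tendsto_ae atTop hgsm hgsl) ?_
    filter_upwards [hgsl, ae_all_iff.2 hgsb] with z h1 h2
    exact le_of_tendsto h1.norm (.of_forall h2)
  simp only [mul_neg, Finset.sum_neg_distrib] at hinteg h
  exact ⟨by simpa using hinteg.neg, by rw [h, integral_neg]⟩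

/-- The expected derivative of the score has full column rank. -/
theorem meanScoreJac_mulVec_injective (hreg : Regular S F B β₀) :
    Function.Injective (S.meanScoreJac F β₀).mulVec := by
  refine (injective_iff_map_eq_zero (S.meanScoreJac F β₀).mulVecLin).2 fun c hc => ?_
  rw [Matrix.mulVecLin_apply] at hc
  have hβ₀ : β₀ ∈ B := interior_subset hreg.true_mem
  have hD : ∀ a, ∫ z, fderiv ℝ (fun b => S.score z b a) β₀ c ∂F = 0 := fun a => by
    have h1 := congrFun hc a
    rw [Matrix.mulVec, dotProduct, Pi.zero_apply] at h1
    rw [← h1]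
    simp only [fderiv_apply_eq_sum]
    rw [integral_finsetSum]
    · simp only [integral_mul_const]
      rfl
    · intro k _
      obtain ⟨H, hH, hHb⟩ := hreg.score_deriv_envelope a 1 (by simp)
      refine Integrable.mul_const (hH.mono'
        (hreg.aemeasurable_fderiv_score a hreg.true_mem _).aestronglyMeasurable ?_) _
      filter_upwards [hHb] with z hz
      have := hz β₀ hreg.true_mem
      rw [abs_norm] at this
      exact (abs_partialDeriv_le _ k β₀).trans this
  set d : Fin n → Datum n q → ℝ := fun t z => deriv S.h (z.2 t ⬝ᵥ β₀) * (z.2 t ⬝ᵥ c) with hd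
  -- For the identity basis matrix the double sum collapses to the diagonal and the two square roots
  -- combine into 1/(φv).
  have hweight : ∀ᵐ z ∂F, ∀ t, ∑ k, c k * S.weight z.2 β₀ (0, k) t =
      d t z * (S.φ * S.v (z.2 t ⬝ᵥ β₀))⁻¹ := by
    filter_upwards [hreg.linPred_mem] with z hz t
    have hpos : 0 < S.φ * S.v (z.2 t ⬝ᵥ β₀) :=
      mul_pos hreg.dispersion_pos (hreg.var_pos _ (hz β₀ hβ₀ t))
    have h1 : ∀ k, S.weight z.2 β₀ (0, k) t = deriv S.h (z.2 t ⬝ᵥ β₀) * z.2 t k *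
        (S.φ * S.v (z.2 t ⬝ᵥ β₀))⁻¹ := fun k => by
      simp only [Spec.weight, hreg.basis_zero, hreg.partialDeriv_mean (hz β₀ hβ₀ _),
        Matrix.one_apply, mul_ite, mul_one, mul_zero, ite_mul, zero_mul, Finset.sum_ite_eq',
        Finset.mem_univ, if_true]
      rw [mul_assoc, ← mul_inv, Real.mul_self_sqrt hpos.le]
    simp only [h1, hd, dotProduct, Finset.mul_sum, Finset.sum_mul]
    exact Finset.sum_congr rfl fun k _ => by ring
  -- Up to sign this integral is `c` contracted with block 0 of Dc, hence zero. Its integrand is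
  -- nonnegative, so every `d t` vanishes almost surely.
  have hquad : ∫ z, ∑ t, d t z ^ 2 * (S.φ * S.v (z.2 t ⬝ᵥ β₀))⁻¹ ∂F = 0 ∧
      Integrable (fun z => ∑ t, d t z ^ 2 * (S.φ * S.v (z.2 t ⬝ᵥ β₀))⁻¹) F := by
    have h1 : (fun z => ∑ k, c k * ∑ t, S.weight z.2 β₀ (0, k) t * d t z) =ᵐ[F]
        fun z => ∑ t, d t z ^ 2 * (S.φ * S.v (z.2 t ⬝ᵥ β₀))⁻¹ := by
      filter_upwards [hweight] with z hz
      simp only [Finset.mul_sum]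
      rw [Finset.sum_comm]
      refine Finset.sum_congr rfl fun t _ => ?_
      rw [sq, mul_assoc, ← hz t, Finset.mul_sum]
      exact Finset.sum_congr rfl fun k _ => by ring
    have h2 : ∀ k, Integrable (fun z => c k * ∑ t, S.weight z.2 β₀ (0, k) t * d t z) F := fun k =>
      (hreg.integral_fderiv_score (0, k) c).1.const_mul _
    refine ⟨?_, (integrable_finsetSum _ fun k _ => h2 k).congr h1⟩
    rw [← integral_congr_ae h1, integral_finsetSum _ fun k _ => h2 k]
    refine Finset.sum_eq_zero fun k _ => ?_
    have h3 := (hreg.integral_fderiv_score (0, k) c).2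
    rw [hD, eq_comm, neg_eq_zero] at h3
    rw [integral_const_mul, h3, mul_zero]
  have hnn : 0 ≤ᵐ[F] fun z => ∑ t, d t z ^ 2 * (S.φ * S.v (z.2 t ⬝ᵥ β₀))⁻¹ := by
    filter_upwards [hreg.linPred_mem] with z hz
    exact Finset.sum_nonneg fun t _ => mul_nonneg (sq_nonneg _) (inv_nonneg.2
      (mul_pos hreg.dispersion_pos (hreg.var_pos _ (hz β₀ hβ₀ t))).le)
  have hzero := (integral_eq_zero_iff_of_nonneg_ae hnn hquad.2).1 hquad.1
  have hscore : ∀ᵐ z ∂F, ∑ k, c k * S.score z β₀ (0, k) = 0 := by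
    filter_upwards [hzero, hweight, hreg.linPred_mem] with z h1 h2 hz
    have hpos : ∀ t, 0 < S.φ * S.v (z.2 t ⬝ᵥ β₀) := fun t =>
      mul_pos hreg.dispersion_pos (hreg.var_pos _ (hz β₀ hβ₀ t))
    have hdt : ∀ t, d t z = 0 := fun t => by
      have := (Finset.sum_eq_zero_iff_of_nonneg fun t _ => mul_nonneg (sq_nonneg (d t z))
        (inv_nonneg.2 (hpos t).le)).1 h1 t (Finset.mem_univ t)
      exact (pow_eq_zero_iff two_ne_zero).1
        ((mul_eq_zero.1 this).resolve_right (inv_ne_zero (hpos t).ne'))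
    simp only [Spec.score_eq_sum, Finset.mul_sum]
    rw [Finset.sum_comm]
    refine Finset.sum_eq_zero fun t _ => ?_
    simp only [← mul_assoc]
    rw [← Finset.sum_mul, h2 t, hdt t, zero_mul, zero_mul]
  by_contra hne
  -- Padded by zeros outside block 0, `c` becomes a null direction of Σ(β₀).
  set u : Fin s × Fin q → ℝ := fun a => if a.1 = 0 then c a.2 else 0 with hu
  have hsum : ∀ φ : Fin s × Fin q → ℝ, ∑ a, u a * φ a = ∑ k, c k * φ (0, k) := fun φ => by
    rw [Fintype.sum_prod_type, Finset.sum_eq_single 0]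
    · simp [hu]
    · intro j _ hj
      simp [hu, hj]
    · simp
  have hune : u ≠ 0 := fun h => hne (funext fun k => by simpa [hu] using congrFun h (0, k))
  have hpos := quadForm_pos (hreg.moment_posDef β₀ hβ₀) hune
  refine hpos.ne' ?_
  have hinteg : ∀ a a', Integrable (fun z => S.score z β₀ a * S.score z β₀ a') F := fun a a' =>
    (hreg.memLp_score hβ₀ a).integrable_mul (hreg.memLp_score hβ₀ a')
  have h1 : u ⬝ᵥ (S.momentMatrix F β₀ *ᵥ u) =
      ∫ z, ∑ a, ∑ a', (u a * u a') * (S.score z β₀ a * S.score z β₀ a') ∂F := by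
    rw [integral_finsetSum _ fun a _ => integrable_finsetSum _ fun a' _ => (hinteg a a').const_mul _]
    refine Finset.sum_congr rfl fun a _ => ?_
    rw [integral_finsetSum _ fun a' _ => (hinteg a a').const_mul _, Matrix.mulVec, dotProduct,
      Finset.mul_sum]
    refine Finset.sum_congr rfl fun a' _ => ?_
    rw [integral_const_mul, Spec.momentMatrix, Matrix.of_apply]
    ring
  rw [h1]
  refine integral_eq_zero_of_ae ?_
  filter_upwards [hscore] with z hz
  rw [← hsum] at hz
  calc ∑ a, ∑ a', (u a * u a') * (S.score z β₀ a * S.score z β₀ a')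
      = (∑ a, u a * S.score z β₀ a) * ∑ a', u a' * S.score z β₀ a' := by
        rw [Finset.sum_mul_sum]
        exact Finset.sum_congr rfl fun a _ => Finset.sum_congr rfl fun a' _ => by ring
    _ = 0 := by rw [hz, zero_mul]

theorem infoMatrix_posDef (hreg : Regular S F B β₀) : (S.infoMatrix F β₀).PosDef :=
  posDef_transpose_mul_inv_mul (hreg.moment_posDef β₀ (interior_subset hreg.true_mem))
    hreg.meanScoreJac_mulVec_injective

end Regular

end ScoreDerivative

/-! ### A measurable expression for the quadratic form in a generalized inverse. -/

section QuadFormMeasurable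

variable {r : Type*} [Fintype r]

/-- The supremum of `2 xᵀ g - xᵀ C x` over a countable dense set of vectors `x`. -/
noncomputable def supQuad (w : (r → ℝ) × (r → r → ℝ)) : ℝ :=
  (⨆ m : ℕ, ((2 * (TopologicalSpace.denseSeq (r → ℝ) m ⬝ᵥ w.1) -
    TopologicalSpace.denseSeq (r → ℝ) m ⬝ᵥ
      (Matrix.of w.2 *ᵥ TopologicalSpace.denseSeq (r → ℝ) m) : ℝ) : EReal)).toReal

lemma measurable_supQuad : Measurable (supQuad (r := r)) := by
  refine measurable_ereal_toReal.comp (Measurable.iSup fun m => ?_)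
  refine measurable_coe_real_ereal.comp ?_
  simp only [dotProduct, Matrix.mulVec, Matrix.of_apply]
  fun_prop

/-- The continuous function x ↦ 2xᵀCu - xᵀCx has its maximum at `u`, and a dense sequence comes
arbitrarily close to it. The left side is a Borel function of its argument although `G` may be any
choice of generalized inverses. -/
lemma supQuad_eq {G : Matrix r r ℝ → Matrix r r ℝ} (hG : IsGenInverse G) {C : Matrix r r ℝ}
    (hC : C.PosSemidef) (u : r → ℝ) :
    supQuad (C *ᵥ u, C) = (C *ᵥ u) ⬝ᵥ (G C *ᵥ (C *ᵥ u)) := by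
  rw [genInverse_quadForm hG (posSemidef_transpose hC)]
  set φ : (r → ℝ) → ℝ := fun x => 2 * (x ⬝ᵥ (C *ᵥ u)) - x ⬝ᵥ (C *ᵥ x) with hφ
  have hφc : Continuous φ := by
    simp only [hφ, dotProduct, Matrix.mulVec]
    fun_prop
  have hu : φ u = u ⬝ᵥ (C *ᵥ u) := by simp only [hφ]; ring
  have hsup : (⨆ m : ℕ, ((φ (TopologicalSpace.denseSeq (r → ℝ) m) : ℝ) : EReal)) =
      ((u ⬝ᵥ (C *ᵥ u) : ℝ) : EReal) := by
    refine le_antisymm (iSup_le fun m => EReal.coe_le_coe_iff.2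
      (two_mul_dotProduct_sub_le hC u _)) (le_of_forall_lt fun c hc => ?_)
    have hopen : IsOpen {x | c < ((φ x : ℝ) : EReal)} :=
      isOpen_lt continuous_const (continuous_coe_real_ereal.comp hφc)
    obtain ⟨m, hm⟩ := (TopologicalSpace.denseRange_denseSeq (r → ℝ)).exists_mem_open hopen
      ⟨u, by simpa [hu] using hc⟩
    exact lt_iSup_iff.2 ⟨m, hm⟩
  have : supQuad (C *ᵥ u, C) =
      (⨆ m : ℕ, ((φ (TopologicalSpace.denseSeq (r → ℝ) m) : ℝ) : EReal)).toReal := rfl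
  rw [this, hsup, EReal.toReal_coe]

end QuadFormMeasurable

/-! ### Algebra of the sample moments. -/

section SampleMoments

variable {n q s : ℕ} {S : Spec n q s}

lemma meanScore_apply (N : ℕ) (ζ : ℕ → Datum n q) (β : Fin q → ℝ) (a : Fin s × Fin q) :
    S.meanScore N ζ β a = (N : ℝ)⁻¹ * ∑ i ∈ Finset.range N, S.score (ζ i) β a := by
  simp [Spec.meanScore]

lemma sampleMoment_apply (N : ℕ) (ζ : ℕ → Datum n q) (β : Fin q → ℝ) (a a' : Fin s × Fin q) :
    S.sampleMoment N ζ β a a' =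
      (N : ℝ)⁻¹ * ∑ i ∈ Finset.range N, S.score (ζ i) β a * S.score (ζ i) β a' := by
  simp [Spec.sampleMoment, Matrix.sum_apply, Matrix.vecMulVec_apply]

lemma sampleMoment_posSemidef (N : ℕ) (ζ : ℕ → Datum n q) (β : Fin q → ℝ) :
    (S.sampleMoment N ζ β).PosSemidef := by
  refine Matrix.PosSemidef.smul (Matrix.posSemidef_sum _ fun i _ => ?_) (by positivity)
  simpa using Matrix.posSemidef_vecMulVec_self_star (S.score (ζ i) β)

/-- With the scores as columns of `A`, the mean score lies in the range of `A`, which is also the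
range of AAᵀ. So even for singular Ĉ_N the objective is independent of the generalized inverse. -/
lemma exists_meanScore_eq (N : ℕ) (ζ : ℕ → Datum n q) (β : Fin q → ℝ) :
    ∃ u, S.sampleMoment N ζ β *ᵥ u = S.meanScore N ζ β := by
  set A : Matrix (Fin s × Fin q) (Fin N) ℝ := Matrix.of fun a i => S.score (ζ i) β a with hA
  have hC : S.sampleMoment N ζ β = (N : ℝ)⁻¹ • (A * Aᵀ) := by
    ext a a'
    rw [sampleMoment_apply, Finset.sum_range]
    simp [hA, Matrix.mul_apply]
  have hg : S.meanScore N ζ β = (N : ℝ)⁻¹ • (A *ᵥ fun _ => 1) := by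
    ext a
    rw [meanScore_apply, Finset.sum_range]
    simp [hA, Matrix.mulVec, dotProduct]
  have hrange : LinearMap.range (A * Aᵀ).mulVecLin = LinearMap.range A.mulVecLin := by
    refine Submodule.eq_of_le_of_finrank_eq ?_ (Matrix.rank_self_mul_transpose A)
    rw [Matrix.mulVecLin_mul]
    exact LinearMap.range_comp_le_range _ _
  obtain ⟨u, hu⟩ : A.mulVecLin (fun _ => 1) ∈ LinearMap.range (A * Aᵀ).mulVecLin := by
    rw [hrange]; exact LinearMap.mem_range_self _ _
  refine ⟨u, ?_⟩
  rw [hC, hg, Matrix.smul_mulVec]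
  exact congrArg _ hu

end SampleMoments

/-! ### From the sample to the deterministic hypotheses, and the limit of Z_N. -/

section Limits

variable {n q s : ℕ} [NeZero s] {S : Spec n q s} {F : Measure (Datum n q)}
  {B : Set (Fin q → ℝ)} {β₀ : Fin q → ℝ} {Ω : Type*} [MeasurableSpace Ω] {P : Measure Ω}
  {ζ : ℕ → Ω → Datum n q}

namespace Regular

lemma aemeasurable_qif (hreg : Regular S F B β₀) (hlaw : ∀ i, HasLaw (ζ i) F P)
    {G : Matrix (Fin s × Fin q) (Fin s × Fin q) ℝ → Matrix (Fin s × Fin q) (Fin s × Fin q) ℝ}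
    (hG : IsGenInverse G) (N : ℕ) {b : Ω → Fin q → ℝ} (hb : AEMeasurable b P)
    (hbB : ∀ᵐ ω ∂P, b ω ∈ B) :
    AEMeasurable (fun ω => S.qif G N (fun i => ζ i ω) (b ω)) P := by
  have hs : ∀ i a, AEMeasurable (fun ω => S.score (ζ i ω) (b ω) a) P := fun i a => by
    refine (Measurable.comp_aemeasurable (hreg.measurable_scoreVersion a)
      ((hlaw i).aemeasurable.prodMk hb)).congr ?_
    filter_upwards [ae_of_hasLaw hlaw hreg.linPred_mem, hbB] with ω h1 h2
    exact (hreg.score_eq (h1 i _ h2) a).symm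
  have hg : AEMeasurable (fun ω => S.meanScore N (fun i => ζ i ω) (b ω)) P := by
    refine aemeasurable_pi_iff.2 fun a => ?_
    simp only [meanScore_apply]
    exact (Finset.aemeasurable_fun_sum _ fun i _ => hs i a).const_mul _
  have hC : AEMeasurable (fun ω a a' => S.sampleMoment N (fun i => ζ i ω) (b ω) a a') P := by
    refine aemeasurable_pi_iff.2 fun a => aemeasurable_pi_iff.2 fun a' => ?_
    simp only [sampleMoment_apply]
    exact (Finset.aemeasurable_fun_sum _ fun i _ => (hs i a).mul (hs i a')).const_mul _
  refine ((measurable_supQuad.comp_aemeasurable (hg.prodMk hC)).const_mul (N : ℝ)).congr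
    (.of_forall fun ω => ?_)
  obtain ⟨u, hu⟩ := exists_meanScore_eq (S := S) N (fun i => ζ i ω) (b ω)
  have := supQuad_eq hG (sampleMoment_posSemidef (S := S) N (fun i => ζ i ω) (b ω)) u
  rw [hu] at this
  simp only [Spec.qif, ← this]
  rfl

lemma eventually_differentiableAt (hreg : Regular S F B β₀) (hlaw : ∀ i, HasLaw (ζ i) F P) :
    ∀ᶠ y : ℕ × Ω in probFilter P, ∀ i a, ∀ β ∈ interior B,
      DifferentiableAt ℝ (fun b => S.score (ζ i y.2) b a) β :=
  eventually_probFilter_of_ae fun _ => ae_of_hasLaw hlaw hreg.differentiableAt_score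

variable [IsProbabilityMeasure P]

lemma tendstoUniformlyOn_meanScore (hreg : Regular S F B β₀) (hlaw : ∀ i, HasLaw (ζ i) F P)
    (hindep : iIndepFun ζ P) (a : Fin s × Fin q) :
    TendstoUniformlyOn (fun (y : ℕ × Ω) β => S.meanScore y.1 (fun i => ζ i y.2) β a)
      (fun β => ∫ z, S.score z β a ∂F) (probFilter P) B ∧
    ContinuousOn (fun β => ∫ z, S.score z β a ∂F) B := by
  obtain ⟨H, hH, hHb⟩ := hreg.score_envelope a
  simp only [meanScore_apply]
  exact uniform_law_of_large_numbers hlaw hindep hreg.isCompact (hreg.continuousOn_score a)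
    (fun β hβ => hreg.aemeasurable_score hβ a) hH hHb

lemma tendstoUniformlyOn_sampleMoment (hreg : Regular S F B β₀) (hlaw : ∀ i, HasLaw (ζ i) F P)
    (hindep : iIndepFun ζ P) (a a' : Fin s × Fin q) :
    TendstoUniformlyOn (fun (y : ℕ × Ω) β => S.sampleMoment y.1 (fun i => ζ i y.2) β a a')
      (fun β => S.momentMatrix F β a a') (probFilter P) B ∧
    ContinuousOn (fun β => S.momentMatrix F β a a') B := by
  obtain ⟨H, hH, hHb⟩ := hreg.prod_envelope a a'
  simp only [sampleMoment_apply]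
  refine uniform_law_of_large_numbers hlaw hindep hreg.isCompact
    (f := fun z β => S.score z β a * S.score z β a') ?_
    (fun β hβ => (hreg.aemeasurable_score hβ a).mul (hreg.aemeasurable_score hβ a')) hH hHb
  filter_upwards [hreg.continuousOn_score a, hreg.continuousOn_score a'] with z h1 h2
  exact h1.mul h2

lemma hasFDerivAt_average {f : ℕ → (Fin q → ℝ) → ℝ} {β : Fin q → ℝ}
    (hf : ∀ i, DifferentiableAt ℝ (f i) β) (N : ℕ) :
    HasFDerivAt (fun b => (N : ℝ)⁻¹ * ∑ i ∈ Finset.range N, f i b)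
      ((N : ℝ)⁻¹ • ∑ i ∈ Finset.range N, fderiv ℝ (f i) β) β :=
  (HasFDerivAt.fun_sum fun i _ => (hf i).hasFDerivAt).const_mul _

lemma partialDeriv_average {f : ℕ → (Fin q → ℝ) → ℝ} {β : Fin q → ℝ}
    (hf : ∀ i, DifferentiableAt ℝ (f i) β) (N : ℕ) (k : Fin q) :
    partialDeriv (fun b => (N : ℝ)⁻¹ * ∑ i ∈ Finset.range N, f i b) k β =
      (N : ℝ)⁻¹ * ∑ i ∈ Finset.range N, partialDeriv (f i) k β := by
  rw [partialDeriv, (hasFDerivAt_average hf N).fderiv]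
  simp [partialDeriv]

lemma tendstoUniformlyOn_partialDeriv_meanScore (hreg : Regular S F B β₀)
    (hlaw : ∀ i, HasLaw (ζ i) F P) (hindep : iIndepFun ζ P) (a : Fin s × Fin q) (k : Fin q)
    {K : Set (Fin q → ℝ)} (hK : IsCompact K) (hKB : K ⊆ interior B) :
    TendstoUniformlyOn (fun (y : ℕ × Ω) β =>
        partialDeriv (fun b => S.meanScore y.1 (fun i => ζ i y.2) b a) k β)
      (fun β => S.meanScoreJac F β a k) (probFilter P) K ∧
    ContinuousOn (fun β => S.meanScoreJac F β a k) K := by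
  obtain ⟨H, hH, hHb⟩ := hreg.score_deriv_envelope a 1 (by simp)
  have h := uniform_law_of_large_numbers hlaw hindep hK
    (f := fun z β => partialDeriv (fun b => S.score z b a) k β)
    ((hreg.continuousOn_partialDeriv_score a k).mono fun z hz => hz.mono hKB)
    (fun β hβ => hreg.aemeasurable_fderiv_score a (hKB hβ) _) hH (by
      filter_upwards [hHb] with z hz β hβ
      have := hz β (hKB hβ)
      rw [abs_norm] at this
      exact (abs_partialDeriv_le _ k β).trans this)
  refine ⟨h.1.congr ?_, h.2⟩
  filter_upwards [hreg.eventually_differentiableAt hlaw] with y hy β hβ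
  simp only [meanScore_apply]
  exact (partialDeriv_average (fun i => hy i a β (hKB hβ)) y.1 k).symm

/-- The value of the limit is irrelevant, since in Z_N these derivatives carry a factor N^(-1/2).
The uniform law on a singleton is the ordinary law of large numbers. -/
lemma exists_tendsto_partialDeriv_sampleMoment (hreg : Regular S F B β₀)
    (hlaw : ∀ i, HasLaw (ζ i) F P) (hindep : iIndepFun ζ P) (a a' : Fin s × Fin q) (k : Fin q) :
    ∃ c, Tendsto (fun y : ℕ × Ω =>
        partialDeriv (fun b => S.sampleMoment y.1 (fun i => ζ i y.2) b a a') k β₀)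
      (probFilter P) (𝓝 c) := by
  obtain ⟨H, hH, hHb⟩ := hreg.prod_deriv_envelope a a' 1 (by simp)
  have h := uniform_law_of_large_numbers hlaw hindep (isCompact_singleton (x := β₀))
    (f := fun z β => partialDeriv (fun b => S.score z b a * S.score z b a') k β)
    (.of_forall fun z => continuousOn_singleton _ _)
    (fun β hβ => by
      rw [Set.mem_singleton_iff.1 hβ]
      exact hreg.aemeasurable_fderiv_prod a a' hreg.true_mem _) hH (by
      filter_upwards [hHb] with z hz β hβ
      rw [Set.mem_singleton_iff.1 hβ]
      have := hz β₀ hreg.true_mem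
      rw [abs_norm] at this
      exact (abs_partialDeriv_le _ k β₀).trans this)
  refine ⟨_, (h.1.tendsto_at (Set.mem_singleton β₀)).congr' ?_⟩
  filter_upwards [hreg.eventually_differentiableAt hlaw] with y hy
  simp only [sampleMoment_apply]
  exact (partialDeriv_average (f := fun i b => S.score (ζ i y.2) b a * S.score (ζ i y.2) b a')
    (fun i => (hy i a β₀ hreg.true_mem).mul (hy i a' β₀ hreg.true_mem)) y.1 k).symm

lemma scoreLimit (hreg : Regular S F B β₀) (hlaw : ∀ i, HasLaw (ζ i) F P)
    (hindep : iIndepFun ζ P) {l : Filter (ℕ × Ω)} (hl : l ≤ probFilter P)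
    {ξ : Fin s × Fin q → ℝ}
    (hξ : Tendsto (fun y : ℕ × Ω => √(y.1 : ℝ) • S.meanScore y.1 (fun i => ζ i y.2) β₀) l (𝓝 ξ)) :
    ScoreLimit l Prod.fst (fun y => S.meanScore y.1 fun i => ζ i y.2)
      (fun y => S.sampleMoment y.1 fun i => ζ i y.2) B β₀ (S.momentMatrix F)
      (S.meanScoreJac F β₀) ξ where
  size := tendsto_fst_probFilter.mono_left hl
  isCompact := hreg.isCompact
  true_mem := hreg.true_mem
  posSemidef y β := sampleMoment_posSemidef _ _ _
  exists_mean := ⟨fun a β => ∫ z, S.score z β a ∂F,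
    fun a u hu => hl ((hreg.tendstoUniformlyOn_meanScore hlaw hindep a).1 u hu),
    fun a => (hreg.tendstoUniformlyOn_meanScore hlaw hindep a).2, hreg.identifiable⟩
  moment a b u hu := hl ((hreg.tendstoUniformlyOn_sampleMoment hlaw hindep a b).1 u hu)
  moment_cont a b := (hreg.tendstoUniformlyOn_sampleMoment hlaw hindep a b).2
  posDef := hreg.moment_posDef
  exists_deriv := by
    obtain ⟨ρ, hρ, hball⟩ := Metric.isOpen_iff.1 isOpen_interior β₀ hreg.true_mem
    have hKB : Metric.closedBall β₀ (ρ / 2) ⊆ interior B :=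
      (Metric.closedBall_subset_ball (by linarith)).trans hball
    have hlim := fun a k => hreg.tendstoUniformlyOn_partialDeriv_meanScore hlaw hindep a k
      (isCompact_closedBall β₀ (ρ / 2)) hKB
    refine ⟨_, Metric.closedBall_mem_nhds β₀ (half_pos hρ), convex_closedBall _ _, ?_,
      fun a k β => S.meanScoreJac F β a k, fun a k u hu => hl ((hlim a k).1 u hu),
      fun a k => (hlim a k).2, fun _ _ => rfl⟩
    filter_upwards [hl (hreg.eventually_differentiableAt hlaw)] with y hy a β hβ
    simp only [meanScore_apply]
    exact (hasFDerivAt_average (fun i => hy i a β (hKB hβ)) y.1).differentiableAt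
  score := hξ

/-- The scaled gradient of the objective at the truth, along a filter on which the normalized
score converges. -/
lemma tendsto_scaledGrad (hreg : Regular S F B β₀) (hlaw : ∀ i, HasLaw (ζ i) F P)
    (hindep : iIndepFun ζ P) {l : Filter (ℕ × Ω)} (hl : l ≤ probFilter P)
    {ξ : Fin s × Fin q → ℝ}
    (hξ : Tendsto (fun y : ℕ × Ω => √(y.1 : ℝ) • S.meanScore y.1 (fun i => ζ i y.2) β₀) l (𝓝 ξ))
    {G : Matrix (Fin s × Fin q) (Fin s × Fin q) ℝ → Matrix (Fin s × Fin q) (Fin s × Fin q) ℝ}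
    (hG : IsGenInverse G) :
    Tendsto (fun y : ℕ × Ω => S.scaledGrad G y.1 (fun i => ζ i y.2) β₀) l
      (𝓝 ((S.meanScoreJac F β₀)ᵀ *ᵥ ((S.momentMatrix F β₀)⁻¹ *ᵥ ξ))) := by
  have H := hreg.scoreLimit hlaw hindep hl hξ
  refine tendsto_pi_nhds.2 fun k => ?_
  choose c hc using fun a a' => hreg.exists_tendsto_partialDeriv_sampleMoment hlaw hindep a a' k
  have hdg : ∀ a, Tendsto (fun y : ℕ × Ω =>
      partialDeriv (fun b => S.meanScore y.1 (fun i => ζ i y.2) b a) k β₀) l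
      (𝓝 (S.meanScoreJac F β₀ a k)) := fun a =>
    ((hreg.tendstoUniformlyOn_partialDeriv_meanScore hlaw hindep a k
      (isCompact_singleton (x := β₀)) (Set.singleton_subset_iff.2 hreg.true_mem)).1.tendsto_at
        (Set.mem_singleton β₀)).mono_left hl
  set X : ℕ × Ω → Fin s × Fin q → ℝ := fun y => (S.sampleMoment y.1 (fun i => ζ i y.2) β₀)⁻¹ *ᵥ
    (√(y.1 : ℝ) • S.meanScore y.1 (fun i => ζ i y.2) β₀) with hX
  have hβB : ∀ᶠ _ in l, β₀ ∈ B := .of_forall fun _ => H.mem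
  have hXl : Tendsto X l (𝓝 ((S.momentMatrix F β₀)⁻¹ *ᵥ ξ)) :=
    tendsto_mulVec (tendsto_matrix_inv (H.tendsto_moment H.mem tendsto_const_nhds hβB)
      (H.posDef _ H.mem).det_pos.ne') hξ
  have hXa := tendsto_pi_nhds.1 hXl
  have hlim1 := tendsto_finsetSum Finset.univ fun a (_ : a ∈ Finset.univ) => (hXa a).mul (hdg a)
  have hlim2 := tendsto_finsetSum Finset.univ fun a (_ : a ∈ Finset.univ) =>
    tendsto_finsetSum Finset.univ fun a' (_ : a' ∈ Finset.univ) =>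
      ((hXa a).mul (hXa a')).mul ((hc a a').mono_left hl)
  -- With X = Ĉ_N⁻¹ √N ḡ_N, the gradient formula gives Z_N = Xᵀ∇ḡ_N - (2√N)⁻¹ XᵀX-weighted
  -- derivatives of Ĉ_N; the second term tends to zero.
  have hlim3 := hlim1.sub (((tendsto_inv_atTop_zero.comp H.tendsto_sqrt_size).const_mul
    (1 / 2 : ℝ)).mul hlim2)
  rw [mul_zero, zero_mul, sub_zero] at hlim3
  have hval : ((S.meanScoreJac F β₀)ᵀ *ᵥ ((S.momentMatrix F β₀)⁻¹ *ᵥ ξ)) k =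
      ∑ a, ((S.momentMatrix F β₀)⁻¹ *ᵥ ξ) a * S.meanScoreJac F β₀ a k := by
    rw [Matrix.mulVec, dotProduct]
    exact Finset.sum_congr rfl fun a _ => by rw [Matrix.transpose_apply, mul_comm]
  rw [hval]
  refine hlim3.congr' ?_
  filter_upwards [H.eventually_posDef H.mem tendsto_const_nhds hβB, H.size_pos,
    hl (hreg.eventually_differentiableAt hlaw)] with y h1 h2 h3
  have hd1 : ∀ a, DifferentiableAt ℝ (fun b => S.meanScore y.1 (fun i => ζ i y.2) b a) β₀ :=
    fun a => by
      simp only [meanScore_apply]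
      exact (hasFDerivAt_average (fun i => h3 i a β₀ hreg.true_mem) y.1).differentiableAt
  have hd2 : ∀ a a', DifferentiableAt ℝ
      (fun b => S.sampleMoment y.1 (fun i => ζ i y.2) b a a') β₀ := fun a a' => by
    simp only [sampleMoment_apply]
    exact (hasFDerivAt_average (f := fun i b => S.score (ζ i y.2) b a * S.score (ζ i y.2) b a')
      (fun i => (h3 i a β₀ hreg.true_mem).mul (h3 i a' β₀ hreg.true_mem)) y.1).differentiableAt
  have hder := (hasFDerivAt_quadForm_inv hd1 hd2
    (fun b => posSemidef_transpose (sampleMoment_posSemidef _ _ _)) h1.det_pos.ne' hG).const_mul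
      (y.1 : ℝ)
  have hpd : partialDeriv (S.qif G y.1 fun i => ζ i y.2) k β₀ = _ :=
    congrArg (fun φ : (Fin q → ℝ) →L[ℝ] ℝ => φ (Pi.single k 1)) hder.fderiv
  rw [Spec.scaledGrad, hpd]
  set x₀ := (S.sampleMoment y.1 (fun i => ζ i y.2) β₀)⁻¹ *ᵥ
    S.meanScore y.1 (fun i => ζ i y.2) β₀ with hx₀
  have hXx : ∀ a, X y a = √(y.1 : ℝ) * x₀ a := fun a => by
    simp only [hX, Matrix.mulVec_smul, Pi.smul_apply, smul_eq_mul, hx₀]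
  simp only [smul_apply, sub_apply,
    sum_apply, smul_eq_mul, hXx, Function.comp_apply]
  change _ = 1 / (2 * √(y.1 : ℝ)) * ((y.1 : ℝ) * (2 * ∑ a, x₀ a *
    partialDeriv (fun b => S.meanScore y.1 (fun i => ζ i y.2) b a) k β₀ -
    ∑ a, ∑ a', x₀ a * x₀ a' *
      partialDeriv (fun b => S.sampleMoment y.1 (fun i => ζ i y.2) b a a') k β₀))
  set r := √(y.1 : ℝ) with hr
  have hN : (y.1 : ℝ) = r * r := (Real.mul_self_sqrt (Nat.cast_nonneg _)).symm
  have e1 : ∀ φ : Fin s × Fin q → ℝ, ∑ a, r * x₀ a * φ a = r * ∑ a, x₀ a * φ a := fun φ => by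
    rw [Finset.mul_sum]; exact Finset.sum_congr rfl fun a _ => by ring
  have e2 : ∀ φ : Fin s × Fin q → Fin s × Fin q → ℝ,
      ∑ a, ∑ a', r * x₀ a * (r * x₀ a') * φ a a' = r * r * ∑ a, ∑ a', x₀ a * x₀ a' * φ a a' :=
    fun φ => by
      simp only [Finset.mul_sum]
      exact Finset.sum_congr rfl fun a _ => Finset.sum_congr rfl fun a' _ => by ring
  rw [e1, e2, hN]
  field_simp

end Regular

end Limits

/-! ### The Wald form as a sum of squares. -/

section WaldForm

variable {ι m k : Type*} [Fintype m] [Fintype k] [DecidableEq m] [DecidableEq k]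

lemma tendsto_waldForm {l : Filter ι} (J : Matrix m m ℝ) (L : Matrix m k ℝ) {x : ι → m → ℝ}
    {z : m → ℝ} (hx : Tendsto x l (𝓝 z)) :
    Tendsto (fun i => waldForm J L (x i)) l (𝓝 (waldForm J L z)) := by
  have h : Tendsto (fun i => (Lᵀ * J⁻¹) *ᵥ x i) l (𝓝 ((Lᵀ * J⁻¹) *ᵥ z)) :=
    tendsto_mulVec tendsto_const_nhds hx
  exact tendsto_dotProduct h (tendsto_mulVec tendsto_const_nhds h)

lemma waldForm_of_isEmpty [IsEmpty k] (J : Matrix m m ℝ) (L : Matrix m k ℝ) (z : m → ℝ) :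
    waldForm J L z = 0 := by
  simp [waldForm]

open scoped MatrixOrder Matrix.Norms.L2Operator in
lemma exists_eq_transpose_mul_self {A : Matrix k k ℝ} (hA : A.PosSemidef) :
    ∃ Q : Matrix k k ℝ, A = Qᵀ * Q := by
  obtain ⟨Q, hQ⟩ := CStarAlgebra.nonneg_iff_eq_star_mul_self.1 hA.nonneg
  exact ⟨Q, by rw [hQ, Matrix.star_eq_conjTranspose, Matrix.conjTranspose_eq_transpose_of_trivial]⟩

/-- The quadratic form is a sum of squares in coordinates that are orthonormal under a covariance
matrix `V` with `J = Dᵀ V⁻¹ D`. -/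
lemma exists_waldForm_eq_sum_sq {r : Type*} [Fintype r] [DecidableEq r] {V : Matrix r r ℝ}
    (hV : V.PosDef) {D : Matrix r m ℝ} (hJ : (Dᵀ * V⁻¹ * D).PosDef) {L : Matrix m k ℝ}
    (hL : Function.Injective L.mulVec) :
    ∃ R : Matrix k r ℝ, R * V * Rᵀ = 1 ∧ ∀ ξ,
      waldForm (Dᵀ * V⁻¹ * D) L (Dᵀ *ᵥ (V⁻¹ *ᵥ ξ)) = ∑ a, (R *ᵥ ξ) a ^ 2 := by
  set J := Dᵀ * V⁻¹ * D with hJdef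
  have hP := posDef_transpose_mul_inv_mul hJ hL
  set A := Lᵀ * J⁻¹ * L with hA
  obtain ⟨Q, hQ⟩ : ∃ Q : Matrix k k ℝ, A⁻¹ = Qᵀ * Q :=
    exists_eq_transpose_mul_self hP.inv.posSemidef
  have hVu : IsUnit V.det := isUnit_iff_ne_zero.2 hV.det_pos.ne'
  have hJu : IsUnit J.det := isUnit_iff_ne_zero.2 hJ.det_pos.ne'
  have hAu : IsUnit A.det := isUnit_iff_ne_zero.2 hP.det_pos.ne'
  have hVs := posSemidef_transpose hV.inv.posSemidef
  have hJs := posSemidef_transpose hJ.inv.posSemidef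
  -- Since QᵀQ = A⁻¹, the form wᵀA⁻¹w is |Qw|². The covariance of these coordinates collapses to
  -- QAQᵀ, which is the identity because QᵀQA is.
  refine ⟨Q * (Lᵀ * J⁻¹ * Dᵀ * V⁻¹), ?_, fun ξ => ?_⟩
  · have h1 : Q * (Lᵀ * J⁻¹ * Dᵀ * V⁻¹) * V * (Q * (Lᵀ * J⁻¹ * Dᵀ * V⁻¹))ᵀ = Q * A * Qᵀ := by
      simp only [Matrix.transpose_mul, Matrix.transpose_transpose, hVs, hJs]
      calc Q * (Lᵀ * J⁻¹ * Dᵀ * V⁻¹) * V * (V⁻¹ * (D * (J⁻¹ * L)) * Qᵀ)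
          = Q * (Lᵀ * J⁻¹ * (Dᵀ * (V⁻¹ * V) * V⁻¹ * D) * J⁻¹ * L) * Qᵀ := by
            simp only [Matrix.mul_assoc]
        _ = Q * (Lᵀ * (J⁻¹ * J) * J⁻¹ * L) * Qᵀ := by
            rw [Matrix.nonsing_inv_mul _ hVu, Matrix.mul_one, ← hJdef]
            simp only [Matrix.mul_assoc]
        _ = Q * A * Qᵀ := by
            rw [Matrix.nonsing_inv_mul _ hJu, Matrix.mul_one]
    rw [h1, mul_eq_one_comm, ← Matrix.mul_assoc, ← hQ, Matrix.nonsing_inv_mul _ hAu]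
  · have h1 : ∑ a, ((Q * (Lᵀ * J⁻¹ * Dᵀ * V⁻¹)) *ᵥ ξ) a ^ 2 =
        (Q *ᵥ ((Lᵀ * J⁻¹) *ᵥ (Dᵀ *ᵥ (V⁻¹ *ᵥ ξ)))) ⬝ᵥ
          (Q *ᵥ ((Lᵀ * J⁻¹) *ᵥ (Dᵀ *ᵥ (V⁻¹ *ᵥ ξ)))) := by
      simp only [dotProduct, sq, Matrix.mulVec_mulVec, Matrix.mul_assoc]
    rw [h1, ← Matrix.transpose_transpose Q, transpose_mulVec_dotProduct, waldForm, ← hA, hQ,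
      Matrix.transpose_transpose, Matrix.mulVec_mulVec _ Qᵀ Q]

end WaldForm

/-! ### The test statistic. -/

section Main

variable {n q s p : ℕ} [NeZero s] {S : Spec n q s} {F : Measure (Datum n q)}
  [IsProbabilityMeasure F] {B : Set (Fin q → ℝ)} {β₀ : Fin q → ℝ} {Ω : Type*} [MeasurableSpace Ω]
  {P : Measure Ω} [IsProbabilityMeasure P] {ζ : ℕ → Ω → Datum n q}

namespace Regular

/-- The score is centered and square integrable at the truth, so its normalized sums are tight. On
events where they are bounded, every ultrafilter has a limit ξ. This ξ may vary with the
ultrafilter, while the limit `c` of `f` may not. -/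
lemma tendsto_of_normalizedScore (hreg : Regular S F B β₀) (hlaw : ∀ i, HasLaw (ζ i) F P)
    (hindep : iIndepFun ζ P) {f : ℕ × Ω → ℝ} {c : ℝ}
    (h : ∀ l : Ultrafilter (ℕ × Ω), (l : Filter (ℕ × Ω)) ≤ probFilter P → ∀ ξ,
      Tendsto (fun y : ℕ × Ω => √(y.1 : ℝ) • S.meanScore y.1 (fun i => ζ i y.2) β₀) l (𝓝 ξ) →
      Tendsto f l (𝓝 c)) : Tendsto f (probFilter P) (𝓝 c) := by
  have hβ₀ : β₀ ∈ B := interior_subset hreg.true_mem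
  refine tendsto_probFilter_of_tight
    (b := fun y => ‖√(y.1 : ℝ) • S.meanScore y.1 (fun i => ζ i y.2) β₀‖)
    (tight_normalized_sum hlaw hindep (f := fun z => S.score z β₀) (hreg.memLp_score hβ₀)
      hreg.integral_score_true) fun b => ?_
  refine (tendsto_iff_ultrafilter _ _ _).2 fun l hl => ?_
  obtain ⟨ξ, hξ⟩ := Ultrafilter.exists_tendsto_of_bounded (l := l) (c := b)
    (x := fun y : ℕ × Ω => √(y.1 : ℝ) • S.meanScore y.1 (fun i => ζ i y.2) β₀) (by
      filter_upwards [le_principal_iff.1 (hl.trans inf_le_right)] with y hy a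
      exact (norm_le_pi_norm _ a).trans hy)
  exact h l (hl.trans inf_le_left) ξ hξ

/-- The difference of the constrained and the unconstrained minimum converges along every
ultrafilter along which the normalized score does. -/
lemma tendsto_testStatistic (hreg : Regular S F B β₀) (hlaw : ∀ i, HasLaw (ζ i) F P)
    (hindep : iIndepFun ζ P)
    {G : Matrix (Fin s × Fin q) (Fin s × Fin q) ℝ → Matrix (Fin s × Fin q) (Fin s × Fin q) ℝ}
    (hG : IsGenInverse G) {L : Matrix (Fin q) (Fin p) ℝ} (hL : Function.Injective L.mulVec)
    {b : Fin p → ℝ} (hH₀ : Lᵀ *ᵥ β₀ = b) {βhat βtil : ℕ → Ω → Fin q → ℝ}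
    (hhat : ∀ N, ∀ᵐ ω ∂P, IsArgMin (S.qif G N fun i => ζ i ω) B (βhat N ω))
    (htil : ∀ N, ∀ᵐ ω ∂P,
      IsArgMin (S.qif G N fun i => ζ i ω) {β ∈ B | Lᵀ *ᵥ β = b} (βtil N ω))
    {l : Ultrafilter (ℕ × Ω)} (hl : (l : Filter (ℕ × Ω)) ≤ probFilter P)
    {ξ : Fin s × Fin q → ℝ}
    (hξ : Tendsto (fun y : ℕ × Ω => √(y.1 : ℝ) • S.meanScore y.1 (fun i => ζ i y.2) β₀) l (𝓝 ξ)) :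
    Tendsto (fun y : ℕ × Ω => S.qif G y.1 (fun i => ζ i y.2) (βtil y.1 y.2) -
      S.qif G y.1 (fun i => ζ i y.2) (βhat y.1 y.2)) l
      (𝓝 (waldForm (S.infoMatrix F β₀) L
        ((S.meanScoreJac F β₀)ᵀ *ᵥ ((S.momentMatrix F β₀)⁻¹ *ᵥ ξ)))) := by
  have H := hreg.scoreLimit hlaw hindep hl hξ
  set Q : ℕ × Ω → (Fin q → ℝ) → ℝ := objective G Prod.fst
    (fun y : ℕ × Ω => S.meanScore y.1 fun i => ζ i y.2)
    (fun y : ℕ × Ω => S.sampleMoment y.1 fun i => ζ i y.2) with hQ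
  have hQq : ∀ y : ℕ × Ω, Q y = S.qif G y.1 fun i => ζ i y.2 := fun _ => rfl
  have htil' : ∀ᶠ y : ℕ × Ω in probFilter P,
      IsArgMin (Q y) {β ∈ B | Lᵀ *ᵥ β = b} (βtil y.1 y.2) := by
    simp only [hQq]
    exact eventually_probFilter_of_ae htil
  -- The unrestricted problem is the constrained one with a matrix without columns. Its Wald form is
  -- zero and the other terms of the two minima cancel.
  have hhat' : ∀ᶠ y : ℕ × Ω in probFilter P,
      IsArgMin (Q y) {β ∈ B | (0 : Matrix (Fin q) (Fin 0) ℝ)ᵀ *ᵥ β = 0} (βhat y.1 y.2) := by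
    have : {β ∈ B | (0 : Matrix (Fin q) (Fin 0) ℝ)ᵀ *ᵥ β = 0} = B :=
      Set.sep_eq_self_iff_mem_true.2 fun _ _ => Subsingleton.elim _ _
    simp only [hQq, this]
    exact eventually_probFilter_of_ae hhat
  have h1 := H.tendsto_objective_argMin hG hreg.infoMatrix_posDef hL hH₀
    (x := fun y => βtil y.1 y.2) (htil'.filter_mono hl)
  have h2 := H.tendsto_objective_argMin hG hreg.infoMatrix_posDef
    (L := (0 : Matrix (Fin q) (Fin 0) ℝ)) (b := 0) (Function.injective_of_subsingleton _)
    (Subsingleton.elim _ _) (x := fun y => βhat y.1 y.2) (hhat'.filter_mono hl)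
  have h3 := h1.sub h2
  simp only [constrainedMin, waldForm_of_isEmpty, add_zero, add_sub_cancel_left] at h3
  exact h3

end Regular

end Main

end QIF

theorem theorem4p2 {n q s p : ℕ} [NeZero s]
    -- model, law of one subject's data, parameter space, true parameter
    (S : QIF.Spec n q s) (F : Measure (QIF.Datum n q)) [IsProbabilityMeasure F]
    (B : Set (Fin q → ℝ)) (β₀ : Fin q → ℝ) (hreg : QIF.Regular S F B β₀)
    -- an i.i.d. sample from `F`
    {Ω : Type*} [MeasurableSpace Ω] (P : Measure Ω) [IsProbabilityMeasure P]
    (ζ : ℕ → Ω → QIF.Datum n q) (hlaw : ∀ i, HasLaw (ζ i) F P) (hindep : iIndepFun ζ P)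
    -- the generalized inverse used in `Q_N`
    (G : Matrix (Fin s × Fin q) (Fin s × Fin q) ℝ → Matrix (Fin s × Fin q) (Fin s × Fin q) ℝ)
    (hG : QIF.IsGenInverse G)
    -- the linear hypothesis, assumed to be true
    (L : Matrix (Fin q) (Fin p) ℝ) (hL : LinearIndependent ℝ L.col) (b : Fin p → ℝ)
    (hH₀ : Lᵀ *ᵥ β₀ = b)
    -- the unrestricted and the constrained minimizers
    (βhat βtil : ℕ → Ω → Fin q → ℝ)
    (hhat_meas : ∀ N, AEMeasurable (βhat N) P) (htil_meas : ∀ N, AEMeasurable (βtil N) P)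
    (hhat : ∀ N, ∀ᵐ ω ∂P, QIF.IsArgMin (S.qif G N fun i => ζ i ω) B (βhat N ω))
    (htil : ∀ N, ∀ᵐ ω ∂P,
      QIF.IsArgMin (S.qif G N fun i => ζ i ω) {β ∈ B | Lᵀ *ᵥ β = b} (βtil N ω)) :
    let J := S.infoMatrix F β₀
    let T : ℕ → Ω → ℝ := fun N ω =>
      S.qif G N (fun i => ζ i ω) (βtil N ω) - S.qif G N (fun i => ζ i ω) (βhat N ω)
    let U : ℕ → Ω → Fin p → ℝ := fun N ω =>
      (Lᵀ * J⁻¹) *ᵥ S.scaledGrad G N (fun i => ζ i ω) β₀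
    J.PosDef ∧
    TendstoInMeasure P (fun N ω => T N ω - U N ω ⬝ᵥ ((Lᵀ * J⁻¹ * L)⁻¹ *ᵥ U N ω)) atTop
      (fun _ => 0) ∧
    TendstoInDistribution T atTop id (fun _ => P) (QIF.chiSquared p) := by
  intro J T U
  have hLinj : Function.Injective L.mulVec := Matrix.mulVec_injective_iff.2 hL
  have hβ₀ : β₀ ∈ B := interior_subset hreg.true_mem
  have hJ : J.PosDef := hreg.infoMatrix_posDef
  refine ⟨hJ, ?_, ?_⟩
  · rw [QIF.tendstoInMeasure_iff_probFilter]
    refine hreg.tendsto_of_normalizedScore hlaw hindep fun l hl ξ hξ => ?_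
    have h1 := hreg.tendsto_testStatistic hlaw hindep hG hLinj hH₀ hhat htil hl hξ
    have h2 := QIF.tendsto_waldForm J L (hreg.tendsto_scaledGrad hlaw hindep hl hξ hG)
    -- Along each ultrafilter both quantities tend to the Wald form at the same DᵀΣ⁻¹ξ, so their
    -- difference tends to 0 whatever ξ is.
    have h3 := h1.sub h2
    rw [sub_self] at h3
    exact h3
  · obtain ⟨R, hR, hRξ⟩ := QIF.exists_waldForm_eq_sum_sq (hreg.moment_posDef β₀ hβ₀) hJ hLinj
    set ψ : QIF.Datum n q → Fin p → ℝ := fun z => R *ᵥ S.score z β₀ with hψ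
    have hinteg : ∀ a a', Integrable (fun z => S.score z β₀ a * S.score z β₀ a') F := fun a a' =>
      (hreg.memLp_score hβ₀ a).integrable_mul (hreg.memLp_score hβ₀ a')
    have hclt := QIF.tendstoInDistribution_chiSquared hlaw hindep (f := ψ)
      (fun j => memLp_finsetSum _ fun a _ => (hreg.memLp_score hβ₀ a).const_mul (R j a))
      (fun j => by
        simp only [hψ, Matrix.mulVec, dotProduct]
        rw [integral_finsetSum _ fun a _ => (hreg.integrable_score hβ₀ a).const_mul _]
        simp [integral_const_mul, hreg.integral_score_true])
      (fun j j' => by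
        have e : ∀ z, ψ z j * ψ z j' =
            ∑ a, ∑ a', (R j a * R j' a') * (S.score z β₀ a * S.score z β₀ a') := fun z => by
          simp only [hψ, Matrix.mulVec, dotProduct, Finset.sum_mul_sum]
          exact Finset.sum_congr rfl fun a _ => Finset.sum_congr rfl fun a' _ => by ring
        simp only [e]
        rw [integral_finsetSum _ fun a _ => integrable_finsetSum _ fun a' _ =>
          (hinteg a a').const_mul _]
        rw [← Matrix.one_apply, ← hR, Matrix.mul_apply]
        simp only [Matrix.mul_apply, Finset.sum_mul]
        rw [Finset.sum_comm]
        refine Finset.sum_congr rfl fun a _ => ?_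
        rw [integral_finsetSum _ fun a' _ => (hinteg a a').const_mul _]
        refine Finset.sum_congr rfl fun a' _ => ?_
        rw [integral_const_mul, QIF.Spec.momentMatrix, Matrix.of_apply, Matrix.transpose_apply]
        ring)
    -- Slutsky's lemma: `T` differs by o_p(1) from the sum of squares of the normalized sums of `ψ`,
    -- whose limit law is known.
    refine tendstoInDistribution_of_tendstoInMeasure_sub T id hclt ?_ fun N => ?_
    · refine QIF.tendstoInMeasure_iff_probFilter.2
        (hreg.tendsto_of_normalizedScore hlaw hindep fun l hl ξ hξ => ?_)
      have h1 := hreg.tendsto_testStatistic hlaw hindep hG hLinj hH₀ hhat htil hl hξ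
      have h2 := QIF.tendsto_waldForm J L (QIF.tendsto_mulVec
        (tendsto_const_nhds (x := (S.meanScoreJac F β₀)ᵀ)) (QIF.tendsto_mulVec
          (tendsto_const_nhds (x := (S.momentMatrix F β₀)⁻¹)) hξ))
      have h3 := h1.sub h2
      rw [sub_self] at h3
      refine h3.congr fun y => ?_
      simp only [Pi.sub_apply]
      congr 1
      refine (hRξ _).trans (Finset.sum_congr rfl fun j _ => ?_)
      congr 1
      -- At N = 0 both sides are 0, as the inverse of zero is zero.
      have hN : √(y.1 : ℝ) * (y.1 : ℝ)⁻¹ = (√(y.1 : ℝ))⁻¹ := by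
        rcases Nat.eq_zero_or_pos y.1 with h | h
        · simp [h]
        · have : (0 : ℝ) < y.1 := Nat.cast_pos.2 h
          rw [← div_eq_mul_inv, Real.sqrt_div_self]
      rw [QIF.Spec.meanScore, smul_smul, hN, Matrix.mulVec_smul, Pi.smul_apply, smul_eq_mul,
        Matrix.mulVec_sum, Finset.sum_apply]
    · exact (hreg.aemeasurable_qif hlaw hG N (htil_meas N)
        ((htil N).mono fun ω hω => hω.1.1)).sub
        (hreg.aemeasurable_qif hlaw hG N (hhat_meas N) ((hhat N).mono fun ω hω => hω.1))
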